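/- Let $n\ge 0$ and $[n]=\{1,\dots,n\}$. Let $\mathcal P_n$ be the partition monoid, i.e. the monoid of all equivalence relations on $[n]\cup[n]'$ (where $[n]'=\{1',\dots,n'\}$ is a disjoint copy of $[n]$) under stacking of diagrams, with the involution $\alpha\mapsto\alpha^*$ interchanging $i$ and $i'$ for all $i$. Let $\mathcal S_n\subseteq\mathcal P_n$ be the symmetric group (the group of units). The rank of $\alpha\in\mathcal P_n$ is the number of its blocks that meet both $[n]$ and $[n]'$; let $J_{n-1}$ be the set of all $\alpha\in\mathcal P_n$ of rank $n-1$. A projection is an element $p$ with $p^2=p=p^*$. By a minimal idempotent generating set of the semigroup $\mathcal P_n\setminus\mathcal S_n$ we mean a set of idempotents that generates this semigroup and has the smallest cardinality among all such sets. Let $\Gamma_n$ be the digraph whose vertices are the projections in $J_{n-1}$, with an edge $p\to q$ if and only if $pq\in J_{n-1}$ (equivalently, $pq\neq0$ in the principal factor $J_{n-1}^*=J_{n-1}\cup\{0\}$). A subgraph of $\Gamma_n$ containing all vertices of $\Gamma_n$ is balanced if each vertex has in-degree $1$ and out-degree $1$ in it; let $\mathcal G_n$ be the set of balanced subgraphs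 of $\Gamma_n$. For $G\in\mathcal G_n$ put $X_G=\{pq : p\to q \text{ is an edge of } G\}$. A function $\phi:Y\to X$ with $Y\subseteq X$ has a $2$-cycle if there are $x\neq y$ in $Y$ with $\phi(x)=y$ and $\phi(y)=x$. Let $a_k$ be the number of permutations of $[k]$ with no fixed points and no $2$-cycles, and for $0\le k\le n$ let $b_{nk}$ be the number of functions $[k]\to[n]$ with no $2$-cycles. Theorem. The map $G\mapsto X_G$ is a bijection from $\mathcal G_n$ onto the set of minimal idempotent generating sets of $\mathcal P_n\setminus\mathcal S_n$, and the number of minimal idempotent generating sets of $\mathcal P_n\setminus\mathcal S_n$ is $$|\mathcal G_n|=\sum_{k=0}^n\binom nk a_k\,b_{n,n-k},$$ where the numbers $a_k$ satisfy $$a_0=1,\qquad a_1=a_2=0,\qquad a_{k+1}=k\,a_k+k(k-1)\,a_{k-2}\quad(k\ge2),$$ and, for $0\le k\le n$, $$b_{nk}=\sum_{i=0}^{\lfloor k/2\rfloor}(-1)^i\binom k{2i}(2i-1)!!\,n^{k-2i},\qquad\text{with } (-1)!!=1 .$$ -/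

import Mathlib

/-- The partition monoid `P_n`: an element is an equivalence relation on `[n] ⊔ [n]'`, where
`Sum.inl i` is the upper vertex `i` and `Sum.inr i` is the lower vertex `i'`. -/
def PartitionMonoid (n : ℕ) : Type := Setoid (Fin n ⊕ Fin n)

namespace PartitionMonoid

variable {n : ℕ}

/-- `α.Rel x y` says that `x` and `y` lie in the same block of `α`. -/
def Rel (α : PartitionMonoid n) (x y : Fin n ⊕ Fin n) : Prop := Setoid.r (self := α) x y

/-- The vertices of the stacked diagram: an upper, a middle and a lower row. -/
inductive Stack (n : ℕ) : Type
  | top (i : Fin n) : Stack n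
  | mid (i : Fin n) : Stack n
  | bot (i : Fin n) : Stack n

/-- The upper diagram occupies the rows `top`, `mid`. -/
def Stack.upper : Fin n ⊕ Fin n → Stack n := Sum.elim Stack.top Stack.mid

/-- The lower diagram occupies the rows `mid`, `bot`. -/
def Stack.lower : Fin n ⊕ Fin n → Stack n := Sum.elim Stack.mid Stack.bot

/-- The vertices that survive when the middle row is deleted. -/
def Stack.outer : Fin n ⊕ Fin n → Stack n := Sum.elim Stack.top Stack.bot

/-- Adjacency in the stacked diagram of `α` (above) and `β` (below). -/
inductive StackRel (α β : PartitionMonoid n) : Stack n → Stack n → Prop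
  | upper {x y : Fin n ⊕ Fin n} : α.Rel x y → StackRel α β (Stack.upper x) (Stack.upper y)
  | lower {x y : Fin n ⊕ Fin n} : β.Rel x y → StackRel α β (Stack.lower x) (Stack.lower y)

/-- The product `αβ`: connected components of the stacked diagram, restricted to the outer rows. -/
instance : Mul (PartitionMonoid n) :=
  ⟨fun α β => Setoid.comap Stack.outer (Relation.EqvGen.setoid (StackRel α β))⟩

/-- The identity has the blocks `{i, i'}`. -/
instance : One (PartitionMonoid n) := ⟨Setoid.ker (Sum.elim id id)⟩

/-- The involution `α ↦ α*` interchanges the upper and the lower row. -/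
instance : Star (PartitionMonoid n) := ⟨fun α => Setoid.comap Sum.swap α⟩

theorem mul_rel (α β : PartitionMonoid n) (x y : Fin n ⊕ Fin n) :
    (α * β).Rel x y ↔ Relation.EqvGen (StackRel α β) (Stack.outer x) (Stack.outer y) := Iff.rfl

theorem one_rel (x y : Fin n ⊕ Fin n) :
    (1 : PartitionMonoid n).Rel x y ↔ Sum.elim id id x = (Sum.elim id id y : Fin n) := Iff.rfl

theorem star_rel (α : PartitionMonoid n) (x y : Fin n ⊕ Fin n) :
    (star α).Rel x y ↔ α.Rel x.swap y.swap := Iff.rfl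

theorem Rel.refl (α : PartitionMonoid n) (x : Fin n ⊕ Fin n) : α.Rel x x :=
  Setoid.refl' (r := α) x

theorem Rel.symm {α : PartitionMonoid n} {x y : Fin n ⊕ Fin n} (h : α.Rel x y) : α.Rel y x :=
  Setoid.symm' (r := α) h

theorem Rel.trans {α : PartitionMonoid n} {x y z : Fin n ⊕ Fin n} (h : α.Rel x y)
    (h' : α.Rel y z) : α.Rel x z :=
  Setoid.trans' (r := α) h h'

/-- The pair of subsets `P ⊆ [n]`, `Q ⊆ [n]` (as predicates) is such that `P ⊔ Q'` is a union of
blocks of `α`. Only used to verify the monoid laws. -/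
def Resp (α : PartitionMonoid n) (P Q : Fin n → Prop) : Prop :=
  ∀ x y, α.Rel x y → (Sum.elim P Q x ↔ Sum.elim P Q y)

theorem resp_mul (α β : PartitionMonoid n) (P R : Fin n → Prop) :
    (α * β).Resp P R ↔ ∃ Q, α.Resp P Q ∧ β.Resp Q R := by
  constructor
  · intro h
    let F : Stack n → Prop := fun z =>
      ∃ u, Relation.EqvGen (StackRel α β) (Stack.outer u) z ∧ Sum.elim P R u
    have hF : ∀ v, F (Stack.outer v) ↔ Sum.elim P R v := fun v =>
      ⟨fun ⟨u, hu, hp⟩ => (h u v hu).1 hp, fun hv => ⟨v, Relation.EqvGen.refl _, hv⟩⟩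
    have hS : ∀ z w, StackRel α β z w → (F z ↔ F w) := fun z w hzw =>
      ⟨fun ⟨u, hu, hp⟩ => ⟨u, hu.trans _ _ _ (.rel _ _ hzw), hp⟩,
        fun ⟨u, hu, hp⟩ => ⟨u, hu.trans _ _ _ (.symm _ _ (.rel _ _ hzw)), hp⟩⟩
    have h1 : ∀ x, Sum.elim P (fun m => F (.mid m)) x ↔ F (Stack.upper x) := by
      rintro (i | i)
      · exact (hF (.inl i)).symm
      · exact Iff.rfl
    have h2 : ∀ x, Sum.elim (fun m => F (.mid m)) R x ↔ F (Stack.lower x) := by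
      rintro (i | i)
      · exact Iff.rfl
      · exact (hF (.inr i)).symm
    refine ⟨fun m => F (.mid m), fun x y hxy => ?_, fun x y hxy => ?_⟩
    · rw [h1, h1]
      exact hS _ _ (.upper hxy)
    · rw [h2, h2]
      exact hS _ _ (.lower hxy)
  · rintro ⟨Q, hα, hβ⟩ x y hxy
    let F : Stack n → Prop := fun z => match z with
      | .top i => P i
      | .mid i => Q i
      | .bot i => R i
    have h1 : ∀ x, F (Stack.upper x) ↔ Sum.elim P Q x := by rintro (i | i) <;> exact Iff.rfl
    have h2 : ∀ x, F (Stack.lower x) ↔ Sum.elim Q R x := by rintro (i | i) <;> exact Iff.rfl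
    have h3 : ∀ x, F (Stack.outer x) ↔ Sum.elim P R x := by rintro (i | i) <;> exact Iff.rfl
    have hS : ∀ z w, Relation.EqvGen (StackRel α β) z w → (F z ↔ F w) := by
      intro z w hzw
      induction hzw with
      | rel z w h =>
        cases h with
        | upper h => rw [h1, h1]; exact hα _ _ h
        | lower h => rw [h2, h2]; exact hβ _ _ h
      | refl z => exact Iff.rfl
      | symm z w _ ih => exact ih.symm
      | trans z w v _ _ ih ih' => exact ih.trans ih'
    rw [← h3, ← h3]
    exact hS _ _ hxy

theorem resp_one (P Q : Fin n → Prop) : (1 : PartitionMonoid n).Resp P Q ↔ P = Q := by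
  constructor
  · intro h
    funext i
    exact propext (h (.inl i) (.inr i) rfl)
  · rintro rfl x y hxy
    have e : ∀ z : Fin n ⊕ Fin n, Sum.elim P P z ↔ P (Sum.elim id id z) := by
      rintro (i | i) <;> exact Iff.rfl
    rw [e, e, (one_rel x y).1 hxy]

theorem rel_of_resp (α β : PartitionMonoid n) (h : ∀ P Q, β.Resp P Q → α.Resp P Q)
    (x y : Fin n ⊕ Fin n) (hxy : α.Rel x y) : β.Rel x y := by
  have e : ∀ z, Sum.elim (fun i => β.Rel x (.inl i)) (fun i => β.Rel x (.inr i)) z ↔ β.Rel x z := by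
    rintro (i | i) <;> exact Iff.rfl
  have := h (fun i => β.Rel x (.inl i)) (fun i => β.Rel x (.inr i))
    (fun u v huv => by rw [e, e]; exact ⟨fun k => k.trans huv, fun k => k.trans huv.symm⟩) x y hxy
  rw [e, e] at this
  exact this.1 (Rel.refl β x)

theorem ext_resp {α β : PartitionMonoid n} (h : ∀ P Q, α.Resp P Q ↔ β.Resp P Q) : α = β :=
  Setoid.ext fun x y => ⟨rel_of_resp α β (fun P Q => (h P Q).2) x y,
    rel_of_resp β α (fun P Q => (h P Q).1) x y⟩

instance : Monoid (PartitionMonoid n) where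
  mul_assoc α β γ := ext_resp fun P Q => by
    simp only [resp_mul]
    constructor
    · rintro ⟨S, ⟨R, h1, h2⟩, h3⟩
      exact ⟨R, h1, S, h2, h3⟩
    · rintro ⟨R, h1, S, h2, h3⟩
      exact ⟨S, ⟨R, h1, h2⟩, h3⟩
  one_mul α := ext_resp fun P Q => by simp [resp_mul, resp_one]
  mul_one α := ext_resp fun P Q => by simp [resp_mul, resp_one]

/-- The domain: the `x ∈ [n]` whose block meets `[n]'`. -/
def dom (α : PartitionMonoid n) : Set (Fin n) := {x | ∃ y, α.Rel (.inl x) (.inr y)}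

/-- The codomain: the `x ∈ [n]` such that the block of `x'` meets `[n]`. -/
def codom (α : PartitionMonoid n) : Set (Fin n) := {x | ∃ y, α.Rel (.inr x) (.inl y)}

/-- The kernel, an equivalence on `[n]`. -/
def ker (α : PartitionMonoid n) : Setoid (Fin n) := Setoid.comap Sum.inl α

/-- The cokernel, an equivalence on `[n]`. -/
def coker (α : PartitionMonoid n) : Setoid (Fin n) := Setoid.comap Sum.inr α

/-- The rank: the number of transversal blocks, those that meet both `[n]` and `[n]'`. -/
noncomputable def rank (α : PartitionMonoid n) : ℕ :=
  Set.ncard {B : Set (Fin n ⊕ Fin n) |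
    B ∈ Setoid.classes α ∧ (∃ i, Sum.inl i ∈ B) ∧ ∃ j, Sum.inr j ∈ B}

/-- The symmetric group `S_n` inside `P_n`: full domain and codomain, trivial kernel and
cokernel. -/
def symmetricPart (n : ℕ) : Set (PartitionMonoid n) :=
  {α | α.dom = Set.univ ∧ α.codom = Set.univ ∧ α.ker = ⊥ ∧ α.coker = ⊥}

/-- The singular part `P_n \ S_n`. -/
def singularPart (n : ℕ) : Set (PartitionMonoid n) := (symmetricPart n)ᶜ

/-- The set `J_{n-1}` of all partitions of rank `n - 1` (which is empty for `n = 0`). -/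
def topClass (n : ℕ) : Set (PartitionMonoid n) := {α | α.rank + 1 = n}

/-- `X` is a set of idempotents that generates the semigroup `P_n \ S_n`. -/
def IsIdempotentGeneratingSet (X : Set (PartitionMonoid n)) : Prop :=
  (∀ x ∈ X, IsIdempotentElem x) ∧
    (Subsemigroup.closure X : Set (PartitionMonoid n)) = singularPart n

/-- An idempotent generating set of `P_n \ S_n` of minimal possible cardinality. -/
def IsMinimalIdempotentGeneratingSet (X : Set (PartitionMonoid n)) : Prop :=
  IsIdempotentGeneratingSet X ∧
    ∀ Y : Set (PartitionMonoid n), IsIdempotentGeneratingSet Y → X.encard ≤ Y.encard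

end PartitionMonoid

/-- The underlying set `J ∪ {0}` of the principal factor `J*` of `J ⊆ M`. -/
def PrincipalFactor {M : Type*} (J : Set M) : Type _ := WithZero J

namespace PrincipalFactor

variable {M : Type*} {J : Set M}

instance : Zero (PrincipalFactor J) := ⟨(none : Option J)⟩

/-- The inclusion of `J` into `J*`. -/
def of (s : J) : PrincipalFactor J := (some s : Option J)

open Classical in
/-- The product in `J*`: it is `st` if `s`, `t` and `st` all lie in `J`, and `0` otherwise. -/
noncomputable instance [Mul M] : Mul (PrincipalFactor J) :=
  ⟨fun a b => match (a : Option J), (b : Option J) with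
    | some s, some t => if h : (s : M) * (t : M) ∈ J then of ⟨(s : M) * (t : M), h⟩ else 0
    | _, _ => 0⟩

end PrincipalFactor

/-- The projection graph `Γ(J*)`: its vertices are the projections in `J` (the non-zero
projections of `J*`), with an edge `p → q` if and only if `pq ≠ 0` in `J*`. -/
def projectionGraph {M : Type*} [Mul M] [Star M] (J : Set M) :
    Digraph {p : J // IsStarProjection (p : M)} where
  Adj p q := PrincipalFactor.of p.1 * PrincipalFactor.of q.1 ≠ 0

/-- A subgraph `H` of `G` on all vertices of `G` is balanced if every vertex has out-degree `1` and
in-degree `1` in `H`. -/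
def Digraph.IsBalancedSubgraph {V : Type*} (H G : Digraph V) : Prop :=
  H ≤ G ∧ ∀ v, {w | H.Adj v w}.encard = 1 ∧ {w | H.Adj w v}.encard = 1

/-- The projection graph `Γ_n = Γ(J_{n-1}*)` of `P_n \ S_n`. -/
def Gam (n : ℕ) : Digraph {p : PartitionMonoid.topClass n //
    IsStarProjection (p : PartitionMonoid n)} :=
  projectionGraph (PartitionMonoid.topClass n)

/-- The set `X_G = {pq : p → q is an edge of G}`, with products taken in `P_n`. -/
def edgeProducts {n : ℕ} (G : Digraph {p : PartitionMonoid.topClass n //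
    IsStarProjection (p : PartitionMonoid n)}) : Set (PartitionMonoid n) :=
  {e | ∃ p q, G.Adj p q ∧ (p.1 : PartitionMonoid n) * (q.1 : PartitionMonoid n) = e}

/-- A map from `{0, …, k-1}` to `{0, …, n-1}` has a 2-cycle if it interchanges two distinct
numbers `x`, `y`. -/
def HasTwoCycle {k n : ℕ} (f : Fin k → Fin n) : Prop :=
  ∃ x y : Fin k, x ≠ y ∧ (f x : ℕ) = (y : ℕ) ∧ (f y : ℕ) = (x : ℕ)

/-- `a_k`: the number of permutations of `k` points with no fixed points and no 2-cycles. -/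
noncomputable def aNum (k : ℕ) : ℕ :=
  Nat.card {π : Equiv.Perm (Fin k) // (∀ x, π x ≠ x) ∧ ¬ HasTwoCycle (π : Fin k → Fin k)}

/-- `b_{nk}`: the number of maps `[k] → [n]` with no 2-cycles. -/
noncomputable def bNum (n k : ℕ) : ℕ :=
  Nat.card {τ : Fin k → Fin n // ¬ HasTwoCycle τ}

/-! Let `J = topClass n`. Each `α ∈ J` has a left projection `αα*` and a right projection `α*α`,
both in `J`, and `αα*` is the only projection of `J` fixing `α` from the left (`mul_star_self_eq`).
So a product lying in `J` inherits its left projection from the first factor and its right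
projection from the last. By `x x* x = x`, a product of two projections is idempotent, and an
idempotent `e` equals `(ee*)(e*e)`. Idempotents of `J` are therefore the same thing as edges of the
projection graph.

A generating set of the singular part must contain, for every projection `p ∈ J`, an element of `J`
with left projection `p` and one with right projection `p`; hence it has at least as many elements
as there are vertices. A balanced subgraph is the graph of a permutation of the vertices, so it
yields at most that many products. Multiplying the products along a cycle through `p` gives an
element with both projections `p`, and by finiteness some power of it is `p`. The projections of `J`
generate everything singular (`singularPart_subset_closure`), so `X_G` generates. Conversely, in a
minimal set each projection occurs exactly once on the left and once on the right, so the edges `xx*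
→ x*x` are balanced (`exists_edgeProducts_eq`).

For the count, the vertices are `pt i` and `pr i j`, indexed by `Sym2 (Fin n)`. Distinct vertices
are adjacent exactly when they are a point and a pair containing it, because all others commute
(`part_mul_part_mem_iff`). A permutation `σ` along this graph is encoded by the map `h` with `σ
{i,i} = {i, h i}` and the set `A` of those `i` with `h i ≠ i` whose pair `{i, h i}` moves on to `h
i` instead of returning to `i`. Here `h` has no 2-cycles, permutes `A` without fixed points, and is
otherwise free off `A`; sorting by `|A| = k` gives `a_k b_{n,n-k}`. The recurrence for `a_k` comes
from cutting one point out of its cycle, the formula for `b_{nk}` from `b_{n,k+2} = n b_{n,k+1} -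
(k+1) b_{nk}`. -/

namespace PartitionMonoid

variable {n : ℕ}

/-! ### Partitions as relations between subsets, and the involution. -/

theorem resp_star (α : PartitionMonoid n) (P Q : Fin n → Prop) :
    (star α).Resp P Q ↔ α.Resp Q P := by
  have e : ∀ (P Q : Fin n → Prop) x, Sum.elim P Q x ↔ Sum.elim Q P x.swap := by
    rintro P Q (i | i) <;> exact Iff.rfl
  constructor
  · intro h x y hxy
    have := h x.swap y.swap (by rw [star_rel]; simpa using hxy)
    rwa [← e, ← e] at this
  · intro h x y hxy
    rw [e P, e P]
    exact h _ _ hxy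

instance : StarMul (PartitionMonoid n) where
  star_involutive α := ext_resp fun P Q => by rw [resp_star, resp_star]
  star_mul α β := ext_resp fun P Q => by
    simp only [resp_mul, resp_star]
    exact exists_congr fun _ => and_comm

theorem resp_iff (α : PartitionMonoid n) (P Q : Fin n → Prop) :
    α.Resp P Q ↔ (∀ i j, α.Rel (.inl i) (.inl j) → (P i ↔ P j)) ∧
      (∀ i j, α.Rel (.inr i) (.inr j) → (Q i ↔ Q j)) ∧
      ∀ i j, α.Rel (.inl i) (.inr j) → (P i ↔ Q j) := by
  constructor
  · exact fun h => ⟨fun i j => h (.inl i) (.inl j), fun i j => h (.inr i) (.inr j),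
      fun i j => h (.inl i) (.inr j)⟩
  · rintro ⟨h1, h2, h3⟩ (i | i) (j | j) hij
    · exact h1 i j hij
    · exact h3 i j hij
    · exact (h3 j i hij.symm).symm
    · exact h2 i j hij

/-- Through `Resp` a partition becomes a relation between subsets of the two rows: products are
compositions, the star is the converse, and by `ext_resp` diagram identities reduce to propositional
logic. -/
theorem mul_star_mul_self (α : PartitionMonoid n) : α * star α * α = α := by
  refine ext_resp fun P R => ?_
  simp only [resp_mul, resp_star]
  constructor
  · rintro ⟨S, ⟨Q, h1, h2⟩, h3⟩
    rw [resp_iff] at h1 h2 h3 ⊢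
    exact ⟨h1.1, h3.2.1, fun i j h =>
      (h1.2.2 i j h).trans ((h2.2.2 i j h).symm.trans (h3.2.2 i j h))⟩
  · exact fun h => ⟨P, ⟨R, h, h⟩, h⟩

instance : Finite (PartitionMonoid n) :=
  Finite.of_injective (fun α : PartitionMonoid n => α.Rel) fun _ _ h =>
    Setoid.ext fun x y => iff_of_eq (congrFun (congrFun h x) y)

/-! ### Rank -/

theorem rel_comm {α : PartitionMonoid n} {x y : Fin n ⊕ Fin n} : α.Rel x y ↔ α.Rel y x :=
  ⟨Rel.symm, Rel.symm⟩

/-- `f` and `g` choose an upper and a lower point in each of `k` distinct transversal blocks. Rank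
estimates below use this form instead of counting blocks. -/
theorem le_rank_iff (α : PartitionMonoid n) (k : ℕ) :
    k ≤ α.rank ↔ ∃ f g : Fin k → Fin n, ∀ i j, α.Rel (.inl (f i)) (.inr (g j)) ↔ i = j := by
  set T : Set (Set (Fin n ⊕ Fin n)) := {B : Set (Fin n ⊕ Fin n) |
    B ∈ Setoid.classes α ∧ (∃ i, Sum.inl i ∈ B) ∧ ∃ j, Sum.inr j ∈ B} with hT
  have hr : α.rank = Nat.card T := rfl
  have hmem : ∀ B ∈ T, ∀ x ∈ B, ∀ y, y ∈ B ↔ α.Rel x y := by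
    rintro _ ⟨⟨z, rfl⟩, -⟩ x hx y
    exact ⟨fun hy => Rel.trans hx (Rel.symm hy), fun hy => Rel.trans (Rel.symm hy) hx⟩
  constructor
  · intro h
    rw [hr, ← Fintype.card_fin k, ← Nat.card_eq_fintype_card] at h
    have : Nonempty (Fin k ↪ T) := by
      have := Fintype.ofFinite T
      exact Function.Embedding.nonempty_of_card_le (by simpa [Nat.card_eq_fintype_card] using h)
    obtain ⟨e⟩ := this
    choose f hf using fun i => (e i).2.2.1
    choose g hg using fun i => (e i).2.2.2
    refine ⟨f, g, fun i j => ?_⟩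
    rw [← hmem _ (e i).2 _ (hf i)]
    constructor
    · intro h
      refine e.injective (Subtype.ext (Set.ext fun z => ?_))
      rw [hmem _ (e i).2 _ h, hmem _ (e j).2 _ (hg j)]
    · rintro rfl
      exact hg i
  · rintro ⟨f, g, h⟩
    have hi : ∀ i, {x | α.Rel x (.inl (f i))} ∈ T := fun i =>
      ⟨⟨_, rfl⟩, ⟨f i, Rel.refl _ _⟩, ⟨g i, ((h i i).2 rfl).symm⟩⟩
    rw [hr, ← Nat.card_fin k]
    refine Nat.card_le_card_of_injective (fun i => (⟨_, hi i⟩ : T)) fun i j hij => ?_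
    have h1 := congrArg (fun B : T => Sum.inr (g j) ∈ B.1) hij
    have h2 : α.Rel (.inr (g j)) (.inl (f i)) ↔ α.Rel (.inr (g j)) (.inl (f j)) := iff_of_eq h1
    rw [rel_comm, h, rel_comm, h] at h2
    exact h2.2 rfl

theorem rank_star (α : PartitionMonoid n) : (star α).rank = α.rank := by
  have h : ∀ β : PartitionMonoid n, β.rank ≤ (star β).rank := by
    intro β
    obtain ⟨f, g, h⟩ := (le_rank_iff β _).1 le_rfl
    refine (le_rank_iff _ _).2 ⟨g, f, fun i j => ?_⟩
    rw [star_rel, rel_comm]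
    exact (h j i).trans eq_comm
  exact le_antisymm (by simpa using h (star α)) (h α)

theorem rank_mul_le_left (α β : PartitionMonoid n) : (α * β).rank ≤ α.rank := by
  obtain ⟨f, g, h⟩ := (le_rank_iff (α * β) _).1 le_rfl
  have hker : ∀ i j, α.Rel (.inl i) (.inl j) → (α * β).Rel (.inl i) (.inl j) := fun i j hij =>
    .rel _ _ (.upper hij)
  have hdom : ∀ i, ∃ m, α.Rel (.inl (f i)) (.inr m) := by
    intro i
    by_contra! hc
    -- An `α`-block that misses the lower row is a union of blocks of `α * β`, which contradicts the
    -- transversal through `f i`.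
    have hr : (α * β).Resp (fun x => α.Rel (.inl (f i)) (.inl x)) (fun _ => False) := by
      rw [resp_mul]
      refine ⟨fun _ => False, (resp_iff _ _ _).2 ⟨fun x y hxy => ?_, by simp, fun x y hxy => ?_⟩,
        (resp_iff _ _ _).2 (by simp)⟩
      · exact ⟨fun k => k.trans hxy, fun k => k.trans hxy.symm⟩
      · exact iff_false_intro fun k => hc _ (k.trans hxy)
    exact (((resp_iff _ _ _).1 hr).2.2 (f i) (g i) ((h i i).2 rfl)).1 (Rel.refl _ _)
  choose m hm using hdom
  refine (le_rank_iff _ _).2 ⟨f, m, fun i j => ⟨fun hij => ?_, fun hij => hij ▸ hm i⟩⟩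
  exact (h i j).1 ((hker _ _ (hij.trans (hm j).symm)).trans ((h j j).2 rfl))

theorem rank_mul_le_right (α β : PartitionMonoid n) : (α * β).rank ≤ β.rank := by
  rw [← rank_star (α * β), ← rank_star β, star_mul]
  exact rank_mul_le_left _ _

theorem injective_of_rel {α : PartitionMonoid n} {k : ℕ} {f g : Fin k → Fin n}
    (h : ∀ i j, α.Rel (.inl (f i)) (.inr (g j)) ↔ i = j) :
    Function.Injective f ∧ Function.Injective g :=
  ⟨fun i j hij => (h i j).1 (hij ▸ (h j j).2 rfl),
    fun i j hij => (h i j).1 (hij ▸ (h i i).2 rfl)⟩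

/-- Otherwise `x` and `y` would extend `f` and `g` to `k + 1` separate transversal blocks. -/
theorem exists_rel_of_rank_le {α : PartitionMonoid n} {k : ℕ} {f g : Fin k → Fin n}
    (h : ∀ i j, α.Rel (.inl (f i)) (.inr (g j)) ↔ i = j) (hk : α.rank ≤ k) {x y : Fin n}
    (hxy : α.Rel (.inl x) (.inr y)) : ∃ i, α.Rel (.inl x) (.inr (g i)) := by
  by_contra hc
  refine (Nat.lt_succ_of_le hk).not_ge
    ((le_rank_iff α (k + 1)).2 ⟨Fin.cons x f, Fin.cons y g, fun a b => ?_⟩)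
  refine Fin.cases ?_ (fun a => ?_) a <;> refine Fin.cases ?_ (fun b => ?_) b
  · simpa using hxy
  · simp only [Fin.cons_zero, Fin.cons_succ]
    exact iff_of_false (fun k => hc ⟨b, k⟩) (Fin.succ_ne_zero b).symm
  · simp only [Fin.cons_zero, Fin.cons_succ]
    refine iff_of_false (fun k => hc ⟨a, ?_⟩) (Fin.succ_ne_zero a)
    exact (hxy.trans k.symm).trans ((h a a).2 rfl)
  · simpa using h a b

theorem mem_symmetricPart_iff (α : PartitionMonoid n) : α ∈ symmetricPart n ↔ n ≤ α.rank := by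
  rw [le_rank_iff]
  constructor
  · rintro ⟨h1, -, h3, -⟩
    have h1' : ∀ i, ∃ j, α.Rel (.inl i) (.inr j) := fun i => by
      have : i ∈ α.dom := h1 ▸ Set.mem_univ i
      exact this
    choose g hg using h1'
    refine ⟨id, g, fun i j => ⟨fun hij => ?_, fun hij => hij ▸ hg i⟩⟩
    have : α.ker i j := hij.trans (hg j).symm
    rw [h3] at this
    exact this
  · rintro ⟨f, g, h⟩
    obtain ⟨hf, hg⟩ := injective_of_rel h
    have hf' := Finite.surjective_of_injective hf
    have hg' := Finite.surjective_of_injective hg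
    refine ⟨Set.eq_univ_of_forall fun x => ?_, Set.eq_univ_of_forall fun x => ?_,
      Setoid.ext fun x y => ⟨fun hxy => ?_, fun hxy => ?_⟩,
      Setoid.ext fun x y => ⟨fun hxy => ?_, fun hxy => ?_⟩⟩
    · obtain ⟨i, rfl⟩ := hf' x
      exact ⟨g i, (h i i).2 rfl⟩
    · obtain ⟨i, rfl⟩ := hg' x
      exact ⟨f i, ((h i i).2 rfl).symm⟩
    · obtain ⟨i, rfl⟩ := hf' x
      obtain ⟨j, rfl⟩ := hf' y
      exact congrArg f ((h i j).1 (Rel.trans hxy ((h j j).2 rfl)))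
    · cases (hxy : x = y)
      exact Setoid.refl' _ _
    · obtain ⟨i, rfl⟩ := hg' x
      obtain ⟨j, rfl⟩ := hg' y
      exact congrArg g ((h i j).1 (Rel.trans ((h i i).2 rfl) hxy))
    · cases (hxy : x = y)
      exact Setoid.refl' _ _

theorem mem_singularPart_iff (α : PartitionMonoid n) : α ∈ singularPart n ↔ α.rank < n := by
  rw [singularPart, Set.mem_compl_iff, mem_symmetricPart_iff, not_le]

theorem mem_topClass_iff {α : PartitionMonoid n} : α ∈ topClass n ↔ α.rank + 1 = n := Iff.rfl

theorem topClass_subset : topClass n ⊆ singularPart n := fun α h => by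
  rw [mem_topClass_iff] at h
  rw [mem_singularPart_iff]
  omega

theorem mul_mem_singularPart_left {α : PartitionMonoid n} (h : α ∈ singularPart n)
    (β : PartitionMonoid n) : α * β ∈ singularPart n := by
  rw [mem_singularPart_iff] at *
  exact (rank_mul_le_left _ _).trans_lt h

theorem mem_topClass_of_mul_left {α β : PartitionMonoid n} (hα : α ∈ singularPart n)
    (h : α * β ∈ topClass n) : α ∈ topClass n := by
  have := rank_mul_le_left α β
  rw [mem_singularPart_iff] at *
  rw [mem_topClass_iff] at *
  omega

theorem star_mem_topClass {α : PartitionMonoid n} (h : α ∈ topClass n) : star α ∈ topClass n := by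
  rwa [mem_topClass_iff, rank_star]

/-! ### The projections of rank `n - 1` -/

open Classical in
/-- The partition with singleton blocks `{i}`, `{i'}` for `i ∈ D` and blocks `{i, i'}` else. -/
noncomputable def hole (D : Set (Fin n)) : PartitionMonoid n :=
  Setoid.ker (Sum.elim (fun j => if j ∈ D then Sum.inl j else Sum.inr j) Sum.inr :
    Fin n ⊕ Fin n → Fin n ⊕ Fin n)

/-- The partition with the blocks `B ∪ B'`, where `B` is a class of `θ`. -/
def diag (θ : Setoid (Fin n)) : PartitionMonoid n := Setoid.comap (Sum.elim id id) θ

open Classical in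
theorem hole_rel (D : Set (Fin n)) (x y : Fin n ⊕ Fin n) : (hole D).Rel x y ↔
    (Sum.elim (fun j => if j ∈ D then Sum.inl j else Sum.inr j) Sum.inr x : Fin n ⊕ Fin n) =
      Sum.elim (fun j => if j ∈ D then Sum.inl j else Sum.inr j) Sum.inr y := Iff.rfl

theorem resp_hole (D : Set (Fin n)) (P Q : Fin n → Prop) :
    (hole D).Resp P Q ↔ ∀ j, j ∉ D → (P j ↔ Q j) := by
  rw [resp_iff]
  constructor
  · intro h j hj
    exact h.2.2 j j (by simp [hole_rel, hj])
  · intro h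
    refine ⟨fun i j hij => ?_, fun i j hij => ?_, fun i j hij => ?_⟩ <;>
      simp only [hole_rel, Sum.elim_inl, Sum.elim_inr] at hij
    · split_ifs at hij
      all_goals simp_all
    · rw [Sum.inr_injective hij]
    · split_ifs at hij <;> simp_all

theorem resp_diag (θ : Setoid (Fin n)) (P Q : Fin n → Prop) :
    (diag θ).Resp P Q ↔ P = Q ∧ ∀ i j, θ i j → (P i ↔ P j) := by
  rw [resp_iff]
  constructor
  · intro h
    exact ⟨funext fun i => propext (h.2.2 i i (θ.refl' i)), h.1⟩
  · rintro ⟨rfl, h⟩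
    exact ⟨h, h, h⟩

/-- The projection of rank `n - 1` with the singletons `{i}` and `{i'}`. -/
noncomputable def pt (i : Fin n) : PartitionMonoid n := hole {i}

/-- The projection with the block `{i, j, i', j'}` and blocks `{k, k'}` else. -/
def pr (i j : Fin n) : PartitionMonoid n := diag (Setoid.ker fun x => if x = j then i else x)

theorem resp_pt (i : Fin n) (P Q : Fin n → Prop) :
    (pt i).Resp P Q ↔ ∀ j, j ≠ i → (P j ↔ Q j) := resp_hole _ _ _

theorem resp_pr (i j : Fin n) (P Q : Fin n → Prop) :
    (pr i j).Resp P Q ↔ P = Q ∧ (P i ↔ P j) := by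
  rw [pr, resp_diag]
  refine and_congr_right fun _ => ⟨fun h => h i j (by simp [Setoid.ker_def]), ?_⟩
  intro h x y hxy
  rw [Setoid.ker_def] at hxy
  split_ifs at hxy <;> simp_all

theorem pr_comm (i j : Fin n) : pr i j = pr j i := ext_resp fun P Q => by
  rw [resp_pr, resp_pr, iff_comm (a := P i)]

theorem star_hole (D : Set (Fin n)) : star (hole D) = hole D := ext_resp fun P Q => by
  rw [resp_star, resp_hole, resp_hole]
  exact forall₂_congr fun _ _ => iff_comm

theorem star_diag (θ : Setoid (Fin n)) : star (diag θ) = diag θ := ext_resp fun P Q => by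
  rw [resp_star, resp_diag, resp_diag]
  constructor <;> (rintro ⟨rfl, h⟩; exact ⟨rfl, h⟩)

theorem hole_mul_self (D : Set (Fin n)) : hole D * hole D = hole D := ext_resp fun P R => by
  simp only [resp_mul, resp_hole]
  exact ⟨fun ⟨Q, h1, h2⟩ j hj => (h1 j hj).trans (h2 j hj), fun h => ⟨R, h, by simp⟩⟩

theorem diag_mul_self (θ : Setoid (Fin n)) : diag θ * diag θ = diag θ := ext_resp fun P R => by
  simp only [resp_mul, resp_diag]
  constructor
  · rintro ⟨Q, ⟨rfl, h1⟩, h2⟩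
    exact h2
  · rintro ⟨rfl, h⟩
    exact ⟨P, ⟨rfl, h⟩, ⟨rfl, h⟩⟩

theorem isStarProjection_pt (i : Fin n) : IsStarProjection (pt i) :=
  ⟨hole_mul_self _, star_hole _⟩

theorem isStarProjection_pr (i j : Fin n) : IsStarProjection (pr i j) :=
  ⟨diag_mul_self _, star_diag _⟩

theorem rel_iff (α : PartitionMonoid n) (x y : Fin n ⊕ Fin n) :
    α.Rel x y ↔ ∀ P Q, α.Resp P Q → (Sum.elim P Q x ↔ Sum.elim P Q y) := by
  refine ⟨fun h P Q hPQ => hPQ x y h, fun h => ?_⟩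
  have e : ∀ z, Sum.elim (fun i => α.Rel x (.inl i)) (fun i => α.Rel x (.inr i)) z ↔ α.Rel x z := by
    rintro (i | i) <;> exact Iff.rfl
  have := h (fun i => α.Rel x (.inl i)) (fun i => α.Rel x (.inr i))
    (fun u v huv => by rw [e, e]; exact ⟨fun k => k.trans huv, fun k => k.trans huv.symm⟩)
  rw [e, e] at this
  exact this.1 (Rel.refl α x)

theorem le_rank_of_succAbove {m : ℕ} (α : PartitionMonoid (m + 1)) (i : Fin (m + 1))
    (h1 : ∀ j, j ≠ i → α.Rel (.inl j) (.inr j))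
    (h2 : ∀ j k, j ≠ i → k ≠ i → α.Rel (.inl j) (.inr k) → j = k) : m ≤ α.rank := by
  refine (le_rank_iff _ _).2 ⟨i.succAbove, i.succAbove, fun j k => ⟨fun h => ?_, ?_⟩⟩
  · exact Fin.succAbove_right_injective
      (h2 _ _ (Fin.succAbove_ne i j) (Fin.succAbove_ne i k) h)
  · rintro rfl
    exact h1 _ (Fin.succAbove_ne i j)

theorem pt_mem_topClass (i : Fin n) : pt i ∈ topClass n := by
  obtain ⟨m, rfl⟩ : ∃ m, n = m + 1 := ⟨n - 1, by have := i.2; omega⟩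
  have h : (pt i).rank < m + 1 := by
    rw [← mem_singularPart_iff]
    intro h
    have : i ∈ (pt i).dom := h.1 ▸ Set.mem_univ i
    obtain ⟨y, hy⟩ := this
    have := (rel_iff _ _ _).1 hy (fun x => x = i) (fun _ => False)
      ((resp_pt _ _ _).2 fun j hj => by simp [hj])
    simp at this
  have h' : m ≤ (pt i).rank := by
    refine le_rank_of_succAbove _ i (fun j hj => ?_) fun j k hj hk hjk => ?_
    · exact (rel_iff _ _ _).2 fun P Q h => (resp_pt _ _ _).1 h j hj
    · have := (rel_iff _ _ _).1 hjk (fun x => x = k) (fun x => x = k)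
        ((resp_pt _ _ _).2 fun _ _ => Iff.rfl)
      simpa using this
  rw [mem_topClass_iff]
  omega

theorem pr_mem_topClass {i j : Fin n} (hij : i ≠ j) : pr i j ∈ topClass n := by
  obtain ⟨m, rfl⟩ : ∃ m, n = m + 1 := ⟨n - 1, by have := i.2; omega⟩
  have h : (pr i j).rank < m + 1 := by
    rw [← mem_singularPart_iff]
    intro h
    have : (pr i j).ker i j := (rel_iff (pr i j) (.inl i) (.inl j)).2 fun P Q h => ((resp_pr _ _ _ _).1 h).2
    rw [h.2.2.1] at this
    exact hij this
  have h' : m ≤ (pr i j).rank := by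
    refine le_rank_of_succAbove _ j (fun k hk => ?_) fun k l hk hl hkl => ?_
    · exact (rel_iff _ _ _).2 fun P Q h => iff_of_eq (congrFun ((resp_pr _ _ _ _).1 h).1 k)
    · have := (rel_iff _ _ _).1 hkl (fun x => (if x = j then i else x) = l)
        (fun x => (if x = j then i else x) = l)
        ((resp_pr _ _ _ _).2 ⟨rfl, by simp [hij]⟩)
      simpa [hk, hl] using this
  rw [mem_topClass_iff]
  omega

/-- The upper representatives `f` of the `n - 1` transversal blocks miss exactly one point `i`. If
the block of `i` reaches the lower row, it contains some `f j0` and the result is a `pr`. If not,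
`{i}` is a block, since every other upper point lies in a transversal block, and the result is a
`pt`. -/
theorem mul_star_self_of_mem_topClass {α : PartitionMonoid n} (hα : α ∈ topClass n) :
    (∃ i, α * star α = pt i) ∨ ∃ i j, i ≠ j ∧ α * star α = pr i j := by
  obtain ⟨m, rfl⟩ : ∃ m, n = m + 1 := ⟨α.rank, by rw [mem_topClass_iff] at hα; omega⟩
  have hm : α.rank = m := by rw [mem_topClass_iff] at hα; omega
  obtain ⟨f, g, h⟩ := (le_rank_iff α m).1 hm.ge
  have hf := (injective_of_rel h).1
  obtain ⟨i, hi, hi'⟩ : ∃ i, (∀ j, f j ≠ i) ∧ ∀ x, x ≠ i → ∃ j, f j = x := by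
    have hns : ¬ Function.Surjective f := fun hs => by
      have := Fintype.card_le_of_surjective f hs
      simp at this
    simp only [Function.Surjective, not_forall, not_exists] at hns
    obtain ⟨i, hi⟩ := hns
    refine ⟨i, hi, fun x hx => ?_⟩
    by_contra! hc
    have hcard := Finset.card_le_card (s := Finset.univ.image f) (t := (Finset.univ.erase i).erase x)
      (fun y hy => by
        obtain ⟨j, -, rfl⟩ := Finset.mem_image.1 hy
        simp [hc j, hi j])
    rw [Finset.card_image_of_injective _ hf, Finset.card_erase_of_mem (by simp [hx]),
      Finset.card_erase_of_mem (Finset.mem_univ _)] at hcard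
    simp at hcard
    have := x.2
    have := i.2
    have : x = i := Fin.ext (by omega)
    exact hx this
  by_cases hc : ∃ j, α.Rel (.inl i) (.inr (g j))
  · obtain ⟨j0, hj0⟩ := hc
    right
    refine ⟨f j0, i, hi j0, ext_resp fun P R => ?_⟩
    simp only [resp_mul, resp_star, resp_pr]
    have hfj : α.Rel (.inl (f j0)) (.inl i) := Rel.trans ((h j0 j0).2 rfl) hj0.symm
    constructor
    · rintro ⟨Q, h1, h2⟩
      rw [resp_iff] at h1 h2
      refine ⟨funext fun x => propext ?_, h1.1 _ _ hfj⟩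
      have hx : ∃ y, α.Rel (.inl x) (.inr y) := by
        by_cases hx : x = i
        · exact ⟨_, hx ▸ hj0⟩
        · obtain ⟨j, rfl⟩ := hi' x hx
          exact ⟨_, (h j j).2 rfl⟩
      obtain ⟨y, hy⟩ := hx
      exact (h1.2.2 x y hy).trans (h2.2.2 x y hy).symm
    · rintro ⟨rfl, hP⟩
      suffices hs : ∃ Q, α.Resp P Q by
        obtain ⟨Q, hQ⟩ := hs
        exact ⟨Q, hQ, hQ⟩
      have hred : ∀ x, ∃ j, α.Rel (.inl x) (.inl (f j)) ∧ (P x ↔ P (f j)) := by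
        intro x
        by_cases hx : x = i
        · exact ⟨j0, hx ▸ hfj.symm, hx ▸ hP.symm⟩
        · obtain ⟨j, rfl⟩ := hi' x hx
          exact ⟨j, Rel.refl _ _, Iff.rfl⟩
      have hker : ∀ x y, α.Rel (.inl x) (.inl y) → (P x ↔ P y) := by
        intro x y hxy
        obtain ⟨j, hj, hj'⟩ := hred x
        obtain ⟨k, hk, hk'⟩ := hred y
        rw [hj', hk', (h j k).1 ((hj.symm.trans (hxy.trans hk)).trans ((h k k).2 rfl))]
      -- The smallest possible `Q`: the lower points joined to `P`.
      refine ⟨fun y => ∃ x, α.Rel (.inl x) (.inr y) ∧ P x, (resp_iff _ _ _).2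
        ⟨hker, fun y z hyz => ?_, fun x y hxy => ?_⟩⟩
      · exact exists_congr fun x => and_congr_left fun _ =>
          ⟨fun k => k.trans hyz, fun k => k.trans hyz.symm⟩
      · exact ⟨fun k => ⟨x, hxy, k⟩, fun ⟨x', k, k'⟩ => (hker x x' (hxy.trans k.symm)).2 k'⟩
  · left
    have hi0 : ∀ y, ¬ α.Rel (.inl i) (.inr y) := fun y hy => hc (exists_rel_of_rank_le h hm.le hy)
    have hi1 : ∀ x, α.Rel (.inl i) (.inl x) → x = i := by
      intro x hx
      by_contra hxi
      obtain ⟨j, rfl⟩ := hi' x hxi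
      exact hi0 _ (hx.trans ((h j j).2 rfl))
    have hker : ∀ x y, α.Rel (.inl x) (.inl y) → x = y := by
      intro x y hxy
      by_cases hx : x = i
      · subst hx
        exact (hi1 y hxy).symm
      · by_cases hy : y = i
        · subst hy
          exact hi1 x hxy.symm
        · obtain ⟨j, rfl⟩ := hi' x hx
          obtain ⟨k, rfl⟩ := hi' y hy
          rw [(h j k).1 (hxy.trans ((h k k).2 rfl))]
    refine ⟨i, ext_resp fun P R => ?_⟩
    simp only [resp_mul, resp_star, resp_pt]
    constructor
    · rintro ⟨Q, h1, h2⟩ x hx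
      rw [resp_iff] at h1 h2
      obtain ⟨j, rfl⟩ := hi' x hx
      exact (h1.2.2 _ _ ((h j j).2 rfl)).trans (h2.2.2 _ _ ((h j j).2 rfl)).symm
    · intro hPR
      have hne : ∀ x y, α.Rel (.inl x) (.inr y) → x ≠ i := fun x y hxy hx => hi0 y (hx ▸ hxy)
      refine ⟨fun y => ∃ x, α.Rel (.inl x) (.inr y) ∧ P x, (resp_iff _ _ _).2
        ⟨fun x y hxy => by rw [hker x y hxy], fun y z hyz => ?_, fun x y hxy => ?_⟩,
        (resp_iff _ _ _).2
        ⟨fun x y hxy => by rw [hker x y hxy], fun y z hyz => ?_, fun x y hxy => ?_⟩⟩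
      · exact exists_congr fun x => and_congr_left fun _ =>
          ⟨fun k => k.trans hyz, fun k => k.trans hyz.symm⟩
      · exact ⟨fun k => ⟨x, hxy, k⟩, fun ⟨x', k, k'⟩ => by rwa [hker x x' (hxy.trans k.symm)]⟩
      · exact exists_congr fun x => and_congr_left fun _ =>
          ⟨fun k => k.trans hyz, fun k => k.trans hyz.symm⟩
      · rw [← hPR x (hne x y hxy)]
        exact ⟨fun k => ⟨x, hxy, k⟩, fun ⟨x', k, k'⟩ => by rwa [hker x x' (hxy.trans k.symm)]⟩

theorem eq_pt_or_pr {p : PartitionMonoid n} (hp : p ∈ topClass n) (h : IsStarProjection p) :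
    (∃ i, p = pt i) ∨ ∃ i j, i ≠ j ∧ p = pr i j := by
  have := mul_star_self_of_mem_topClass hp
  rwa [h.isSelfAdjoint.star_eq, h.isIdempotentElem.eq] at this

end PartitionMonoid

namespace PartitionMonoid

variable {n : ℕ}

/-! ### The singular part is generated by the projections of rank `n - 1` -/

/-- The unit with the blocks `{i, (s i)'}`. -/
def perm (s : Equiv.Perm (Fin n)) : PartitionMonoid n := Setoid.ker (Sum.elim s id)

theorem resp_perm (s : Equiv.Perm (Fin n)) (P Q : Fin n → Prop) :
    (perm s).Resp P Q ↔ ∀ j, P j ↔ Q (s j) := by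
  have hr : ∀ x y, (perm s).Rel x y ↔ Sum.elim s id x = Sum.elim s id y := fun _ _ => Iff.rfl
  simp only [resp_iff, hr, Sum.elim_inl, Sum.elim_inr, id]
  constructor
  · exact fun h j => h.2.2 j (s j) rfl
  · intro h
    refine ⟨fun i j hij => by rw [s.injective hij], fun i j hij => by rw [hij], ?_⟩
    rintro i _ rfl
    exact h i

theorem perm_mul_perm (s t : Equiv.Perm (Fin n)) : perm s * perm t = perm (t * s) :=
  ext_resp fun P R => by
    simp only [resp_mul, resp_perm]
    refine ⟨fun ⟨Q, h1, h2⟩ j => (h1 j).trans (h2 _), fun h => ⟨fun j => R (t j), h, by simp⟩⟩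

theorem perm_one : perm (1 : Equiv.Perm (Fin n)) = 1 := ext_resp fun P R => by
  simp only [resp_perm, resp_one, funext_iff, eq_iff_iff, Equiv.Perm.one_apply]

theorem perm_mul_pt (s : Equiv.Perm (Fin n)) (i : Fin n) :
    perm s * pt (s i) = pt i * perm s := ext_resp fun P R => by
  simp only [resp_mul, resp_perm, resp_pt]
  constructor
  · rintro ⟨Q, h1, h2⟩
    exact ⟨fun j => R (s j), fun j hj => (h1 j).trans (h2 _ (s.injective.ne hj)), by simp⟩
  · rintro ⟨Q, h1, h2⟩
    refine ⟨fun j => P (s.symm j), by simp, fun j hj => ?_⟩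
    simp only [h1 _ (show s.symm j ≠ i by rwa [Ne, Equiv.symm_apply_eq]), h2,
      Equiv.apply_symm_apply]

theorem perm_mul_pr (s : Equiv.Perm (Fin n)) (i j : Fin n) :
    perm s * pr (s i) (s j) = pr i j * perm s := ext_resp fun P R => by
  simp only [resp_mul, resp_perm, resp_pr]
  constructor
  · rintro ⟨Q, h1, rfl, h2⟩
    exact ⟨P, ⟨rfl, by rw [h1, h1, h2]⟩, h1⟩
  · rintro ⟨Q, ⟨rfl, h1⟩, h2⟩
    exact ⟨R, h2, rfl, by rw [← h2, ← h2, h1]⟩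

/-- The block `{i, k}` lets the upper point `k` leave at the lower point `i`, so the hole moves from
`i` to `k`. This is the source of all permutations in the closure. -/
theorem pt_mul_pr_mul_pt {i k : Fin n} (hik : i ≠ k) :
    pt i * pr i k * pt k = pt i * perm (Equiv.swap i k) := ext_resp fun P R => by
  simp only [resp_mul, resp_perm, resp_pr, resp_pt]
  constructor
  · rintro ⟨Q, ⟨S, h1, rfl, h2⟩, h3⟩
    refine ⟨fun j => R (Equiv.swap i k j), fun j hj => ?_, by simp⟩
    by_cases hjk : j = k
    · subst hjk
      simp only [Equiv.swap_apply_right, ← h3 i hik, h2, h1 _ hj]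
    · simp only [Equiv.swap_apply_of_ne_of_ne hj hjk, ← h3 j hjk, h1 j hj]
  · rintro ⟨Q, h1, h2⟩
    refine ⟨fun j => if j = k then R i else R j, ⟨_, fun j hj => ?_, rfl, by simp [hik]⟩,
      fun j hj => by simp [hj]⟩
    rw [h1 j hj, h2]
    by_cases hjk : j = k
    · simp [hjk]
    · simp [hjk, Equiv.swap_apply_of_ne_of_ne hj hjk]

/-- The projections of rank `n - 1`. -/
def topProjections (n : ℕ) : Set (PartitionMonoid n) := {p | p ∈ topClass n ∧ IsStarProjection p}

theorem pt_mem_topProjections (i : Fin n) : pt i ∈ topProjections n :=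
  ⟨pt_mem_topClass i, isStarProjection_pt i⟩

theorem pr_mem_topProjections {i j : Fin n} (h : i ≠ j) : pr i j ∈ topProjections n :=
  ⟨pr_mem_topClass h, isStarProjection_pr i j⟩

local notation "𝕋" => Subsemigroup.closure (topProjections _)

theorem pt_mem (i : Fin n) : pt i ∈ 𝕋 := Subsemigroup.subset_closure (pt_mem_topProjections i)

theorem pr_mem {i j : Fin n} (h : i ≠ j) : pr i j ∈ 𝕋 :=
  Subsemigroup.subset_closure (pr_mem_topProjections h)

/-- `s` carries the hole from `i` to `s i`, where the second factor has its own, so no further point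
is lost. -/
theorem pt_mul_perm_mul (i : Fin n) (s t : Equiv.Perm (Fin n)) :
    (pt i * perm s) * (pt (s i) * perm t) = pt i * perm (t * s) := by
  rw [← mul_assoc, mul_assoc (pt i), perm_mul_pt, ← mul_assoc, (isStarProjection_pt i).1.eq,
    mul_assoc, perm_mul_perm]

theorem pt_mul_perm_swap_left_mem {i k : Fin n} (h : i ≠ k) :
    pt i * perm (Equiv.swap i k) ∈ 𝕋 := by
  rw [← pt_mul_pr_mul_pt h]
  exact mul_mem (mul_mem (pt_mem i) (pr_mem h)) (pt_mem k)

theorem pt_mul_perm_swap_mem (i : Fin n) {k l : Fin n} (hkl : k ≠ l) :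
    pt i * perm (Equiv.swap k l) ∈ 𝕋 := by
  by_cases hk : i = k
  · subst hk
    exact pt_mul_perm_swap_left_mem hkl
  by_cases hl : i = l
  · rw [Equiv.swap_comm]
    subst hl
    exact pt_mul_perm_swap_left_mem hkl.symm
  -- The hole travels `i → k → l → i`; the three swaps compose to `swap k l`.
  have h := mul_mem (mul_mem (pt_mul_perm_swap_left_mem hk) (pt_mul_perm_swap_left_mem hkl))
    (pt_mul_perm_swap_left_mem (Ne.symm hl))
  have h1 := pt_mul_perm_mul i (Equiv.swap i k) (Equiv.swap k l)
  rw [Equiv.swap_apply_left] at h1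
  have h2 := pt_mul_perm_mul i (Equiv.swap k l * Equiv.swap i k) (Equiv.swap l i)
  rw [Equiv.Perm.mul_apply, Equiv.swap_apply_left, Equiv.swap_apply_left] at h2
  rw [h1, h2] at h
  convert h using 3
  ext x
  simp only [Equiv.Perm.mul_apply, Equiv.swap_apply_def]
  split_ifs <;> simp_all

theorem pt_mul_perm_mem (s : Equiv.Perm (Fin n)) : ∀ i, pt i * perm s ∈ 𝕋 := by
  induction s using Equiv.Perm.swap_induction_on with
  | one => intro i; rw [perm_one, mul_one]; exact pt_mem i
  | swap_mul f k l hkl ih =>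
    intro i
    rw [← pt_mul_perm_mul]
    exact mul_mem (ih i) (pt_mul_perm_swap_mem _ hkl)

/-- The hole at `i` is bypassed through `j`, which is in the same block on both sides. -/
theorem pr_mul_pt_mul_pr {i j : Fin n} (hij : i ≠ j) : pr i j * pt i * pr i j = pr i j := by
  refine ext_resp fun P R => ?_
  simp only [resp_mul, resp_pr, resp_pt]
  constructor
  · rintro ⟨Q, ⟨S, ⟨rfl, h1⟩, h2⟩, rfl, h3⟩
    refine ⟨funext fun x => propext ?_, h1⟩
    by_cases hx : x = i
    · subst hx
      rw [h1, h3, h2 j hij.symm]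
    · exact h2 x hx
  · rintro ⟨rfl, h⟩
    exact ⟨P, ⟨P, ⟨rfl, h⟩, fun _ _ => Iff.rfl⟩, rfl, h⟩

theorem mul_perm_mem {x : PartitionMonoid n} (hx : x ∈ 𝕋) (s : Equiv.Perm (Fin n)) :
    x * perm s ∈ 𝕋 := by
  induction hx using Subsemigroup.closure_induction with
  | mem x hx =>
    rcases eq_pt_or_pr hx.1 hx.2 with ⟨i, rfl⟩ | ⟨i, j, hij, rfl⟩
    · exact pt_mul_perm_mem s i
    · rw [← pr_mul_pt_mul_pr hij, mul_assoc, ← perm_mul_pr, mul_assoc, ← mul_assoc (pt i)]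
      exact mul_mem (pr_mem hij) (mul_mem (pt_mul_perm_mem s i) (pr_mem (s.injective.ne hij)))
  | mul x y hx hy _ ih =>
    rw [mul_assoc]
    exact mul_mem hx ih

theorem star_mem {x : PartitionMonoid n} (hx : x ∈ 𝕋) : star x ∈ 𝕋 := by
  induction hx using Subsemigroup.closure_induction with
  | mem x hx =>
    rw [hx.2.isSelfAdjoint.star_eq]
    exact Subsemigroup.subset_closure hx
  | mul x y _ _ ih ih' =>
    rw [star_mul]
    exact mul_mem ih' ih

theorem diag_mul_mem (θ : Setoid (Fin n)) {x : PartitionMonoid n} (hx : x ∈ 𝕋) :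
    diag θ * x ∈ 𝕋 := by
  -- `diag θ` is a product of `pr i j` over pairs of `θ`. The empty product `1` is not singular, so
  -- the induction carries "left multiplication by `d` preserves the closure" instead of membership.
  have key : ∀ F : Finset (Fin n × Fin n), ∃ d : PartitionMonoid n, (∀ x ∈ 𝕋, d * x ∈ 𝕋) ∧
      ∀ P Q, d.Resp P Q ↔ P = Q ∧ ∀ e ∈ F, (P e.1 ↔ P e.2) := by
    intro F
    induction F using Finset.induction_on with
    | empty => exact ⟨1, by simp, by simp [resp_one]⟩
    | insert e F _ ih =>
      obtain ⟨d, h1, h2⟩ := ih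
      by_cases he : e.1 = e.2
      · exact ⟨d, h1, fun P Q => by simp [h2, he]⟩
      · refine ⟨pr e.1 e.2 * d, fun x hx => ?_, fun P R => ?_⟩
        · rw [mul_assoc]
          exact mul_mem (pr_mem he) (h1 x hx)
        · simp only [resp_mul, resp_pr, h2, Finset.forall_mem_insert]
          exact ⟨fun ⟨Q, ⟨h3, h4⟩, h5, h6⟩ => by subst h3; exact ⟨h5, h4, h6⟩,
            fun ⟨h3, h4, h5⟩ => ⟨P, ⟨rfl, h4⟩, h3, h5⟩⟩
  classical
  obtain ⟨d, h1, h2⟩ := key (Finset.univ.filter fun e => θ e.1 e.2)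
  have : diag θ = d := ext_resp fun P Q => by simp [resp_diag, h2]
  exact this ▸ h1 x hx

theorem mul_diag_mem (θ : Setoid (Fin n)) {x : PartitionMonoid n} (hx : x ∈ 𝕋) :
    x * diag θ ∈ 𝕋 := by
  have := star_mem (diag_mul_mem θ (star_mem hx))
  rwa [star_mul, star_star, star_diag] at this

theorem hole_mem {D : Set (Fin n)} (hD : D.Nonempty) : hole D ∈ 𝕋 := by
  obtain ⟨i, hi⟩ := hD
  have key : ∀ F : Set (Fin n), F.Finite → hole (insert i F) ∈ 𝕋 := by
    intro F hF
    induction F, hF using Set.Finite.induction_on with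
    | empty => rw [insert_empty_eq]; exact pt_mem i
    | @insert j F _ _ ih =>
      have : hole (insert i (insert j F)) = pt j * hole (insert i F) := ext_resp fun P R => by
        simp only [resp_mul, resp_pt, resp_hole]
        constructor
        · intro h
          refine ⟨fun x => if x = j then R x else P x, fun x hx => by simp [hx], fun x hx => ?_⟩
          by_cases hj : x = j
          · simp [hj]
          · simp only [hj, if_false]
            exact h x (by simp_all)
        · rintro ⟨Q, h1, h2⟩ x hx
          simp only [Set.mem_insert_iff, not_or] at hx h2
          exact (h1 x hx.2.1).trans (h2 x ⟨hx.1, hx.2.2⟩)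
      rw [this]
      exact mul_mem (pt_mem j) ih
  simpa [Set.insert_eq_of_mem hi] using key D (Set.toFinite D)

/-- `α` factors into its kernel, a partial permutation matching representatives of the transversal
blocks, and its cokernel. Rank below `n` leaves a nonempty hole, so the middle factor is in the
closure; the outer factors preserve it. Inside the hole the values of the extension `s` do not
matter. -/
theorem singularPart_subset_closure :
    singularPart n ⊆ (Subsemigroup.closure (topProjections n) : Set (PartitionMonoid n)) := by
  intro α hα
  rw [mem_singularPart_iff] at hα
  obtain ⟨f, g, h⟩ := (le_rank_iff α _).1 le_rfl
  obtain ⟨hf, hg⟩ := injective_of_rel h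
  let s : Equiv.Perm (Fin n) :=
    ((Equiv.ofInjective f hf).symm.trans (Equiv.ofInjective g hg)).extendSubtype
  have hs : ∀ i, s (f i) = g i := fun i => by
    rw [Equiv.extendSubtype_apply_of_mem _ _ ⟨i, rfl⟩]
    simp [Equiv.ofInjective_symm_apply]
  have hD : (Set.range f)ᶜ.Nonempty := by
    rw [Set.nonempty_compl, Ne, Set.range_eq_univ]
    intro hsurj
    have := Fintype.card_le_of_surjective f hsurj
    simp at this
    omega
  have hfac : α = diag α.ker * (hole (Set.range f)ᶜ * perm s) * diag α.coker := by
    refine ext_resp fun P R => ?_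
    have hm : ∀ P R, (hole (Set.range f)ᶜ * perm s).Resp P R ↔ ∀ i, P (f i) ↔ R (g i) := by
      intro P R
      simp only [resp_mul, resp_perm, resp_hole, Set.mem_compl_iff, not_not, Set.forall_mem_range]
      exact ⟨fun ⟨Q, h1, h2⟩ i => by rw [h1, h2, hs],
        fun h => ⟨fun j => R (s j), fun i => by simp only [h, hs], by simp⟩⟩
    rw [resp_mul]
    simp only [resp_mul (diag _), hm, resp_diag]
    constructor
    · intro hPR
      rw [resp_iff] at hPR
      exact ⟨R, ⟨P, ⟨rfl, hPR.1⟩, fun i => hPR.2.2 _ _ ((h i i).2 rfl)⟩, rfl, hPR.2.1⟩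
    · rintro ⟨_, ⟨_, ⟨rfl, h1⟩, h2⟩, rfl, h3⟩
      refine (resp_iff _ _ _).2 ⟨h1, h3, fun x y hxy => ?_⟩
      obtain ⟨i, hi⟩ := exists_rel_of_rank_le h le_rfl hxy
      rw [h1 x (f i) (hi.trans ((h i i).2 rfl).symm), h2, h3 (g i) y (hi.symm.trans hxy)]
  rw [hfac]
  exact mul_diag_mem _ (diag_mul_mem _ (mul_perm_mem (hole_mem hD) s))

end PartitionMonoid

/-! ### Balanced subgraphs as permutations, and nonzero products in the principal factor. -/

theorem Digraph.isBalancedSubgraph_iff {V : Type*} {H G : Digraph V} :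
    H.IsBalancedSubgraph G ↔ H ≤ G ∧ ∃ σ : Equiv.Perm V, ∀ v w, H.Adj v w ↔ σ v = w := by
  refine and_congr_right fun _ => ⟨fun h => ?_, ?_⟩
  · simp only [Set.encard_eq_one] at h
    choose f hf using fun v => (h v).1
    choose g hg using fun v => (h v).2
    have hf' : ∀ v w, H.Adj v w ↔ w = f v := fun v w => Set.ext_iff.1 (hf v) w
    have hg' : ∀ v w, H.Adj w v ↔ w = g v := fun v w => Set.ext_iff.1 (hg v) w
    refine ⟨⟨f, g, fun v => ?_, fun v => ?_⟩, fun v w => (hf' v w).trans eq_comm⟩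
    · exact ((hg' (f v) v).1 ((hf' v _).2 rfl)).symm
    · exact ((hf' (g v) v).1 ((hg' v _).2 rfl)).symm
  · rintro ⟨σ, hσ⟩ v
    simp only [Set.encard_eq_one, hσ]
    exact ⟨⟨σ v, Set.ext fun w => eq_comm⟩,
      ⟨σ.symm v, Set.ext fun w => (Equiv.eq_symm_apply σ).symm⟩⟩

theorem PrincipalFactor.of_mul_of_ne_zero {M : Type*} [Mul M] {J : Set M} (s t : J) :
    of s * of t ≠ 0 ↔ (s : M) * (t : M) ∈ J := by
  classical
  have : of s * of t = if h : (s : M) * (t : M) ∈ J then of ⟨(s : M) * (t : M), h⟩ else 0 := rfl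
  rw [this]
  split_ifs with h
  · exact iff_of_true (Option.some_ne_none _) h
  · exact iff_of_false (fun h => h rfl) h

namespace PartitionMonoid

variable {n : ℕ}

/-! ### Left and right projections -/

/-- A partition fixed by `pt i` from the left has `i` isolated in its upper row, so the value of `P`
at `i` is free. -/
theorem pt_mul_eq {i : Fin n} {α : PartitionMonoid n} (h : pt i * α = α) {P P' R : Fin n → Prop}
    (hα : α.Resp P R) (hP : ∀ j, j ≠ i → (P' j ↔ P j)) : α.Resp P' R := by
  rw [← h, resp_mul]
  exact ⟨P, (resp_pt _ _ _).2 hP, hα⟩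

theorem pr_mul_eq {i j : Fin n} {α : PartitionMonoid n} (h : pr i j * α = α) {P R : Fin n → Prop}
    (hα : α.Resp P R) : P i ↔ P j := by
  rw [← h, resp_mul] at hα
  obtain ⟨Q, h1, -⟩ := hα
  exact ((resp_pr _ _ _ _).1 h1).2

open Classical in
/-- The projections of rank `n - 1`, indexed by the points and the pairs of points. -/
noncomputable def part (u : Sym2 (Fin n)) : PartitionMonoid n :=
  Sym2.lift ⟨fun i j => if i = j then pt i else pr i j, fun i j => by
    by_cases h : i = j
    · simp [h]
    · simp [h, Ne.symm h, pr_comm i j]⟩ u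

theorem part_self (i : Fin n) : part s(i, i) = pt i := by simp [part]

theorem part_of_ne {i j : Fin n} (h : i ≠ j) : part s(i, j) = pr i j := by simp [part, h]

theorem sym2_cases {α : Type*} {motive : Sym2 α → Prop} (self : ∀ i, motive s(i, i))
    (ne : ∀ i j, i ≠ j → motive s(i, j)) (u : Sym2 α) : motive u := by
  induction u using Sym2.ind with
  | _ i j =>
    by_cases h : i = j
    · exact h ▸ self i
    · exact ne i j h

theorem part_mem (u : Sym2 (Fin n)) : part u ∈ topProjections n := by
  induction u using sym2_cases with
  | self i => rw [part_self]; exact pt_mem_topProjections i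
  | ne i j h => rw [part_of_ne h]; exact pr_mem_topProjections h

theorem exists_part_eq {p : PartitionMonoid n} (hp : p ∈ topProjections n) :
    ∃ u, part u = p := by
  rcases eq_pt_or_pr hp.1 hp.2 with ⟨i, rfl⟩ | ⟨i, j, hij, rfl⟩
  · exact ⟨_, part_self i⟩
  · exact ⟨_, part_of_ne hij⟩

/-- A projection leaves a mark on whatever it fixes from the left: an isolated upper point, or two
joined upper points. `part v` carries no mark but its own. -/
theorem eq_of_part_mul_part {u v : Sym2 (Fin n)} (h : part u * part v = part v) : u = v := by
  induction u using sym2_cases with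
  | self i =>
    rw [part_self] at h
    have hT : (part v).Resp (fun _ => True) (fun _ => True) := by
      intro x y _
      cases x <;> cases y <;> exact Iff.rfl
    have := pt_mul_eq h (P' := fun j => j ≠ i) hT (by simp)
    induction v using sym2_cases with
    | self k =>
      rw [part_self, resp_pt] at this
      by_contra hne
      simpa using this i fun hik => hne (hik ▸ rfl)
    | ne k l hkl =>
      rw [part_of_ne hkl, resp_pr] at this
      simpa using congrFun this.1 i
  | ne i j hij =>
    rw [part_of_ne hij] at h
    induction v using sym2_cases with
    | self k =>
      rw [part_self] at h
      have := pr_mul_eq h (P := fun x => x = i) (R := fun x => x = i)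
        ((resp_pt _ _ _).2 fun _ _ => Iff.rfl)
      exact absurd this (by simp [hij.symm])
    | ne k l hkl =>
      rw [part_of_ne hkl] at h
      have h1 : ¬ (¬ i = k ∧ ¬ i = l) := fun hc => by
        have := pr_mul_eq h (P := fun x => x = i) (R := fun x => x = i)
          ((resp_pr _ _ _ _).2 ⟨rfl, by simp [Ne.symm hc.1, Ne.symm hc.2]⟩)
        exact absurd this (by simp [hij.symm])
      have h2 : ¬ (¬ j = k ∧ ¬ j = l) := fun hc => by
        have := pr_mul_eq h (P := fun x => x = j) (R := fun x => x = j)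
          ((resp_pr _ _ _ _).2 ⟨rfl, by simp [Ne.symm hc.1, Ne.symm hc.2]⟩)
        exact absurd this (by simp [hij])
      rw [Sym2.eq_iff]
      by_cases hik : i = k
      · have : j ≠ k := hik ▸ hij.symm
        exact Or.inl ⟨hik, by tauto⟩
      · have hil : i = l := by tauto
        have : j ≠ l := hil ▸ hij.symm
        exact Or.inr ⟨hil, by tauto⟩

theorem eq_of_mul_eq {p q : PartitionMonoid n} (hp : p ∈ topProjections n)
    (hq : q ∈ topProjections n) (h : p * q = q) : p = q := by
  obtain ⟨u, rfl⟩ := exists_part_eq hp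
  obtain ⟨v, rfl⟩ := exists_part_eq hq
  rw [eq_of_part_mul_part h]

theorem mul_star_self_mem {α : PartitionMonoid n} (hα : α ∈ topClass n) :
    α * star α ∈ topProjections n := by
  refine ⟨?_, ?_, ?_⟩
  · have h1 := rank_mul_le_left α (star α)
    have h2 := rank_mul_le_left (α * star α) α
    rw [mul_star_mul_self] at h2
    rw [mem_topClass_iff] at *
    omega
  · rw [IsIdempotentElem, ← mul_assoc, mul_star_mul_self]
  · rw [IsSelfAdjoint, star_mul, star_star]

theorem star_mul_self_mem {α : PartitionMonoid n} (hα : α ∈ topClass n) :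
    star α * α ∈ topProjections n := by
  simpa using mul_star_self_mem (star_mem_topClass hα)

theorem mul_star_self_eq {p α : PartitionMonoid n} (hα : α ∈ topClass n)
    (hp : p ∈ topProjections n) (h : p * α = α) : α * star α = p :=
  (eq_of_mul_eq hp (mul_star_self_mem hα) (by rw [← mul_assoc, h])).symm

theorem star_mul_self_eq {p α : PartitionMonoid n} (hα : α ∈ topClass n)
    (hp : p ∈ topProjections n) (h : α * p = α) : star α * α = p := by
  have := mul_star_self_eq (star_mem_topClass hα) hp (by
    rw [← hp.2.isSelfAdjoint.star_eq, ← star_mul, h])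
  rwa [star_star] at this

/-- The product of the two projections is `α* (αβ) β*`, so its rank bounds that of `αβ` from below.
-/
theorem mul_mem_topClass {α β : PartitionMonoid n} (hα : α ∈ topClass n)
    (h : (star α * α) * (β * star β) ∈ topClass n) : α * β ∈ topClass n := by
  have h1 := rank_mul_le_left α β
  have h2 := rank_mul_le_left (star α * (α * β)) (star β)
  have h3 := rank_mul_le_right (star α) (α * β)
  have h4 : (star α * α) * (β * star β) = (star α * (α * β)) * star β := by
    simp only [mul_assoc]
  rw [h4] at h
  rw [mem_topClass_iff] at *
  omega

theorem mul_mem_topClass_of_eq {α β : PartitionMonoid n} (hα : α ∈ topClass n)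
    (h : star α * α = β * star β) : α * β ∈ topClass n := by
  refine mul_mem_topClass hα ?_
  have := star_mul_self_mem hα
  rw [← h, this.2.isIdempotentElem.eq]
  exact this.1

theorem mul_mul_star_mul {α β : PartitionMonoid n} (hα : α ∈ singularPart n)
    (h : α * β ∈ topClass n) : (α * β) * star (α * β) = α * star α :=
  mul_star_self_eq h (mul_star_self_mem (mem_topClass_of_mul_left hα h))
    (by rw [← mul_assoc, mul_star_mul_self])

theorem star_mul_mul_mul {α β : PartitionMonoid n} (hβ : β ∈ topClass n)
    (h : α * β ∈ topClass n) : star (α * β) * (α * β) = star β * β :=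
  star_mul_self_eq h (star_mul_self_mem hβ)
    (by rw [mul_assoc, ← mul_assoc β, mul_star_mul_self])


theorem mul_mul_star_mul_of_proj {p q : PartitionMonoid n} (hp : p ∈ topProjections n)
    (h : p * q ∈ topClass n) : (p * q) * star (p * q) = p :=
  mul_star_self_eq h hp (by rw [← mul_assoc, hp.2.isIdempotentElem.eq])

theorem star_mul_mul_mul_of_proj {p q : PartitionMonoid n} (hq : q ∈ topProjections n)
    (h : p * q ∈ topClass n) : star (p * q) * (p * q) = q :=
  star_mul_self_eq h hq (by rw [mul_assoc, hq.2.isIdempotentElem.eq])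

/-- For `x = pq` the law `x x* x = x` reads `p q q p p q = pq`, that is `pqpq = pq`. -/
theorem isIdempotentElem_mul_of_proj {p q : PartitionMonoid n} (hp : IsStarProjection p)
    (hq : IsStarProjection q) : IsIdempotentElem (p * q) := by
  have h := mul_star_mul_self (p * q)
  have hp' : ∀ x, p * (p * x) = p * x := fun x => by rw [← mul_assoc, hp.isIdempotentElem.eq]
  have hq' : ∀ x, q * (q * x) = q * x := fun x => by rw [← mul_assoc, hq.isIdempotentElem.eq]
  rw [star_mul, hp.isSelfAdjoint.star_eq, hq.isSelfAdjoint.star_eq] at h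
  simp only [mul_assoc, hp', hq'] at h
  rw [IsIdempotentElem, mul_assoc, h]

/-- `e e* e* e = e (ee)* e = e e* e = e`. Hence an idempotent is determined by its two projections.
-/
theorem mul_star_self_mul_star_mul_self {e : PartitionMonoid n} (he : IsIdempotentElem e) :
    (e * star e) * (star e * e) = e := by
  rw [mul_assoc, ← mul_assoc (star e), ← star_mul, he.eq, ← mul_assoc, mul_star_mul_self]

/-! ### Generating sets -/

/-- The projections of rank `n - 1`, the vertices of `Gam n`. -/
abbrev Vertex (n : ℕ) : Type := {p : topClass n // IsStarProjection (p : PartitionMonoid n)}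

/-- The underlying partition of a vertex. -/
def toPart (p : Vertex n) : PartitionMonoid n := p.1.1

theorem toPart_mem (p : Vertex n) : toPart p ∈ topProjections n := ⟨p.1.2, p.2⟩

theorem toPart_injective : Function.Injective (toPart (n := n)) := fun _ _ h =>
  Subtype.ext (Subtype.ext h)

theorem Gam_adj (p q : Vertex n) : (Gam n).Adj p q ↔ toPart p * toPart q ∈ topClass n :=
  PrincipalFactor.of_mul_of_ne_zero _ _

/-- A vertex from a projection of rank `n - 1`. -/
def vertexMk {p : PartitionMonoid n} (h : p ∈ topProjections n) : Vertex n := ⟨⟨p, h.1⟩, h.2⟩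

theorem mem_edgeProducts {G : Digraph (Vertex n)} {e : PartitionMonoid n} :
    e ∈ edgeProducts G ↔ ∃ p q : Vertex n, G.Adj p q ∧ toPart p * toPart q = e := Iff.rfl

theorem adj_iff_mem_edgeProducts {G : Digraph (Vertex n)} (hG : G ≤ Gam n) (p q : Vertex n) :
    G.Adj p q ↔ ∃ e ∈ edgeProducts G, e * star e = toPart p ∧ star e * e = toPart q := by
  constructor
  · intro h
    have hpq : toPart p * toPart q ∈ topClass n := (Gam_adj p q).1 (hG h)
    exact ⟨_, mem_edgeProducts.2 ⟨p, q, h, rfl⟩, mul_mul_star_mul_of_proj (toPart_mem p) hpq,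
      star_mul_mul_mul_of_proj (toPart_mem q) hpq⟩
  · rintro ⟨_, ⟨p', q', h, rfl⟩, h1, h2⟩
    have hpq : toPart p' * toPart q' ∈ topClass n := (Gam_adj p' q').1 (hG h)
    have h1' := mul_mul_star_mul_of_proj (toPart_mem p') hpq
    have h2' := star_mul_mul_mul_of_proj (toPart_mem q') hpq
    rw [← toPart_injective (h1'.symm.trans h1), ← toPart_injective (h2'.symm.trans h2)]
    exact h

theorem edgeProducts_injOn : Set.InjOn (edgeProducts (n := n)) {G | G ≤ Gam n} := by
  intro G hG H hH h
  ext p q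
  rw [adj_iff_mem_edgeProducts hG, adj_iff_mem_edgeProducts hH, h]

/-- `x` lies in the finite group of elements with left and right projection `p`, whose identity `p`
is therefore a positive power of `x`. -/
theorem mem_closure_of_star_mul_self_eq {S : Subsemigroup (PartitionMonoid n)}
    {x p : PartitionMonoid n} (hx : x ∈ S) (hxJ : x ∈ topClass n)
    (h1 : x * star x = p) (h2 : star x * x = p) : p ∈ S := by
  have hpow : ∀ k, x ^ (k + 1) ∈ S ∧ star (x ^ (k + 1)) * x ^ (k + 1) = p := by
    intro k
    have hJ : ∀ k, x ^ (k + 1) ∈ topClass n ∧ star (x ^ (k + 1)) * x ^ (k + 1) = p := by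
      intro k
      induction k with
      | zero => simpa using ⟨hxJ, h2⟩
      | succ k ih =>
        have := mul_mem_topClass_of_eq ih.1 (ih.2.trans h1.symm)
        rw [pow_succ]
        exact ⟨this, (star_mul_mul_mul hxJ this).trans h2⟩
    refine ⟨?_, (hJ k).2⟩
    induction k with
    | zero => simpa using hx
    | succ k ih => rw [pow_succ]; exact mul_mem ih hx
  have hpx : p * x = x := by rw [← h1, mul_star_mul_self]
  obtain ⟨a, b, hab, h⟩ := Finite.exists_ne_map_eq_of_infinite fun k : ℕ => x ^ (k + 1)
  wlog hlt : a < b generalizing a b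
  · exact this b a hab.symm h.symm (lt_of_le_of_ne (not_lt.1 hlt) hab.symm)
  obtain ⟨c, rfl⟩ : ∃ c, b = a + (c + 1) := ⟨b - a - 1, by omega⟩
  have h3 : x ^ (a + (c + 1) + 1) = x ^ (a + 1) * x ^ (c + 1) := by rw [← pow_add]; congr 1; omega
  -- Cancelling `x ^ (a + 1)` by its star turns the coincidence of powers into `p = p * x ^ (c +
  -- 1)`.
  have h4 := congrArg (star (x ^ (a + 1)) * ·) h
  simp only [h3, ← mul_assoc, (hpow a).2] at h4
  rw [h4, pow_succ', ← mul_assoc, hpx, ← pow_succ']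
  exact (hpow c).1

theorem closure_eq_singularPart {S : Subsemigroup (PartitionMonoid n)}
    (h1 : topProjections n ⊆ S) (h2 : (S : Set (PartitionMonoid n)) ⊆ singularPart n) :
    (S : Set (PartitionMonoid n)) = singularPart n :=
  h2.antisymm (singularPart_subset_closure.trans (Subsemigroup.closure_le.2 h1))

/-- The singular part as a subsemigroup. -/
def singularSubsemigroup (n : ℕ) : Subsemigroup (PartitionMonoid n) where
  carrier := singularPart n
  mul_mem' h _ := mul_mem_singularPart_left h _

theorem isIdempotentGeneratingSet_edgeProducts {G : Digraph (Vertex n)}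
    (hG : G.IsBalancedSubgraph (Gam n)) : IsIdempotentGeneratingSet (edgeProducts G) := by
  obtain ⟨hle, σ, hσ⟩ := Digraph.isBalancedSubgraph_iff.1 hG
  refine ⟨?_, closure_eq_singularPart ?_ ?_⟩
  · rintro _ ⟨p, q, -, rfl⟩
    exact isIdempotentElem_mul_of_proj p.2 q.2
  · intro p hp
    have hedge : ∀ v : Vertex n, toPart v * toPart (σ v) ∈ topClass n := fun v =>
      (Gam_adj _ _).1 (hle ((hσ v _).2 rfl))
    have hmem : ∀ v : Vertex n,
        toPart v * toPart (σ v) ∈ Subsemigroup.closure (edgeProducts G) := fun v =>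
      Subsemigroup.subset_closure (mem_edgeProducts.2 ⟨v, _, (hσ v _).2 rfl, rfl⟩)
    -- A walk of `k + 1` edges from `v`: neighbouring factors share a projection, so the product
    -- stays in `topClass n`. After `orderOf σ` edges the walk closes up at `v`.
    have key : ∀ (k : ℕ) (v : Vertex n), ∃ x ∈ Subsemigroup.closure (edgeProducts G),
        x ∈ topClass n ∧ x * star x = toPart v ∧ star x * x = toPart ((σ ^ (k + 1)) v) := by
      intro k v
      induction k with
      | zero =>
        exact ⟨_, hmem v, hedge v, mul_mul_star_mul_of_proj (toPart_mem v) (hedge v),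
          star_mul_mul_mul_of_proj (toPart_mem (σ v)) (hedge v)⟩
      | succ k ih =>
        obtain ⟨x, h1, h2, h3, h4⟩ := ih
        set w := (σ ^ (k + 1)) v with hw
        have h5 : x * (toPart w * toPart (σ w)) ∈ topClass n := mul_mem_topClass_of_eq h2
          (h4.trans (mul_mul_star_mul_of_proj (toPart_mem w) (hedge w)).symm)
        refine ⟨_, mul_mem h1 (hmem w), h5, (mul_mul_star_mul (topClass_subset h2) h5).trans h3,
          (star_mul_mul_mul (hedge w) h5).trans ?_⟩
        rw [star_mul_mul_mul_of_proj (toPart_mem (σ w)) (hedge w), pow_succ' σ (k + 1),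
          Equiv.Perm.mul_apply]
    have hfin : orderOf σ ≠ 0 := (isOfFinOrder_of_finite σ).orderOf_pos.ne'
    obtain ⟨x, h1, h2, h3, h4⟩ := key (orderOf σ - 1) (vertexMk hp)
    rw [Nat.sub_one_add_one hfin, pow_orderOf_eq_one, Equiv.Perm.one_apply] at h4
    exact mem_closure_of_star_mul_self_eq h1 h2 h3 h4
  · refine Subsemigroup.closure_le (S := singularSubsemigroup n).2 ?_
    rintro _ ⟨p, q, -, rfl⟩
    exact mul_mem_singularPart_left (topClass_subset p.1.2) _

/-- When `p` is written as a product over `Y`, the first factor has rank `n - 1` and left projection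
`p`. This gives the lower bound for generating sets. -/
theorem exists_mem_mul_star_self_eq {Y : Set (PartitionMonoid n)}
    (hY : (Subsemigroup.closure Y : Set (PartitionMonoid n)) = singularPart n)
    {p : PartitionMonoid n} (hp : p ∈ topProjections n) :
    ∃ y ∈ Y, y ∈ topClass n ∧ y * star y = p := by
  have key : ∀ x ∈ Subsemigroup.closure Y, x ∈ topClass n →
      ∃ y ∈ Y, y ∈ topClass n ∧ y * star y = x * star x := by
    intro x hx
    induction hx using Subsemigroup.closure_induction with
    | mem x hx => exact fun h => ⟨x, hx, h, rfl⟩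
    | mul a b ha _ ih _ =>
      intro h
      have ha' : a ∈ singularPart n := hY ▸ ha
      obtain ⟨y, h1, h2, h3⟩ := ih (mem_topClass_of_mul_left ha' h)
      exact ⟨y, h1, h2, h3.trans (mul_mul_star_mul ha' h).symm⟩
  have hp' : p ∈ (Subsemigroup.closure Y : Set (PartitionMonoid n)) :=
    hY ▸ topClass_subset hp.1
  obtain ⟨y, h1, h2, h3⟩ := key p hp' hp.1
  rw [hp.2.isSelfAdjoint.star_eq, hp.2.isIdempotentElem.eq] at h3
  exact ⟨y, h1, h2, h3⟩

theorem closure_star (Y : Set (PartitionMonoid n)) {x : PartitionMonoid n}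
    (hx : x ∈ Subsemigroup.closure Y) : star x ∈ Subsemigroup.closure (star '' Y) := by
  induction hx using Subsemigroup.closure_induction with
  | mem x hx => exact Subsemigroup.subset_closure ⟨x, hx, rfl⟩
  | mul a b _ _ ih ih' => rw [star_mul]; exact mul_mem ih' ih

theorem star_mem_singularPart {x : PartitionMonoid n} (hx : x ∈ singularPart n) :
    star x ∈ singularPart n := by
  rw [mem_singularPart_iff] at *
  rwa [rank_star]

theorem exists_mem_star_mul_self_eq {Y : Set (PartitionMonoid n)}
    (hY : (Subsemigroup.closure Y : Set (PartitionMonoid n)) = singularPart n)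
    {p : PartitionMonoid n} (hp : p ∈ topProjections n) :
    ∃ y ∈ Y, y ∈ topClass n ∧ star y * y = p := by
  have hY' : (Subsemigroup.closure (star '' Y) : Set (PartitionMonoid n)) = singularPart n := by
    refine Set.Subset.antisymm ?_ fun x hx => ?_
    · refine (Subsemigroup.closure_le (S := singularSubsemigroup n)).2 ?_
      rintro _ ⟨y, hy, rfl⟩
      exact star_mem_singularPart (hY ▸ Subsemigroup.subset_closure hy)
    · have : star x ∈ (Subsemigroup.closure Y : Set (PartitionMonoid n)) :=
        hY ▸ star_mem_singularPart hx
      simpa using closure_star Y this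
  obtain ⟨_, ⟨y, h1, rfl⟩, h2, h3⟩ := exists_mem_mul_star_self_eq hY' hp
  exact ⟨y, h1, by simpa using star_mem_topClass h2, by rwa [star_star] at h3⟩

theorem encard_vertex_le {Y : Set (PartitionMonoid n)}
    (hY : (Subsemigroup.closure Y : Set (PartitionMonoid n)) = singularPart n) :
    (Set.univ : Set (Vertex n)).encard ≤ Y.encard := by
  choose f h1 _ h3 using fun v : Vertex n => exists_mem_mul_star_self_eq hY (toPart_mem v)
  exact Set.encard_le_encard_of_injOn (fun v _ => h1 v) fun v _ w _ h =>
    toPart_injective (by rw [← h3 v, ← h3 w, h])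

theorem encard_edgeProducts_le {G : Digraph (Vertex n)} (hG : G.IsBalancedSubgraph (Gam n)) :
    (edgeProducts G).encard ≤ (Set.univ : Set (Vertex n)).encard := by
  obtain ⟨-, σ, hσ⟩ := Digraph.isBalancedSubgraph_iff.1 hG
  have : edgeProducts G = (fun v : Vertex n => toPart v * toPart (σ v)) '' Set.univ := by
    ext e
    simp [mem_edgeProducts, hσ]
  rw [this]
  exact Set.encard_image_le _ _

theorem isMinimalIdempotentGeneratingSet_edgeProducts {G : Digraph (Vertex n)}
    (hG : G.IsBalancedSubgraph (Gam n)) : IsMinimalIdempotentGeneratingSet (edgeProducts G) :=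
  ⟨isIdempotentGeneratingSet_edgeProducts hG, fun _ hY =>
    (encard_edgeProducts_le hG).trans (encard_vertex_le hY.2)⟩

theorem exists_isBalancedSubgraph (n : ℕ) :
    ∃ G : Digraph (Vertex n), G.IsBalancedSubgraph (Gam n) := by
  refine ⟨⟨Eq⟩, Digraph.isBalancedSubgraph_iff.2 ⟨?_, 1, fun _ _ => Iff.rfl⟩⟩
  rintro v _ rfl
  rw [Gam_adj, (toPart_mem v).2.isIdempotentElem.eq]
  exact (toPart_mem v).1

theorem range_eq_of_encard_le {α β : Type*} [Finite α] {X : Set β} {f : α → β}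
    (hf : ∀ a, f a ∈ X) (hinj : Function.Injective f)
    (hX : X.encard ≤ (Set.univ : Set α).encard) : Set.range f = X := by
  have hle : X.encard ≤ (Set.range f).encard := by
    rwa [← Set.image_univ, hinj.encard_image]
  exact (Set.finite_range f).eq_of_subset_of_encard_le
    (Set.range_subset_iff.2 hf) hle

/-- `X` has no more elements than there are vertices, because the balanced subgraph of all loops
does not. So the choices `f`, `g` of elements with prescribed left or right projection both exhaust
`X`, and each projection occurs once on either side. -/
theorem exists_edgeProducts_eq {X : Set (PartitionMonoid n)}
    (hX : IsMinimalIdempotentGeneratingSet X) :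
    ∃ G : Digraph (Vertex n), G.IsBalancedSubgraph (Gam n) ∧ edgeProducts G = X := by
  obtain ⟨G₀, hG₀⟩ := exists_isBalancedSubgraph n
  have hcard : X.encard ≤ (Set.univ : Set (Vertex n)).encard :=
    (hX.2 _ (isIdempotentGeneratingSet_edgeProducts hG₀)).trans (encard_edgeProducts_le hG₀)
  choose f f1 f2 f3 using fun v : Vertex n => exists_mem_mul_star_self_eq hX.1.2 (toPart_mem v)
  choose g g1 g2 g3 using fun v : Vertex n => exists_mem_star_mul_self_eq hX.1.2 (toPart_mem v)
  have hf := range_eq_of_encard_le f1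
    (fun v w h => toPart_injective (by rw [← f3 v, ← f3 w, h])) hcard
  have hg := range_eq_of_encard_le g1
    (fun v w h => toPart_injective (by rw [← g3 v, ← g3 w, h])) hcard
  have hL : ∀ x ∈ X, ∀ v : Vertex n, x * star x = toPart v ↔ x = f v := by
    intro x hx v
    rw [← hf] at hx
    obtain ⟨w, rfl⟩ := hx
    refine ⟨fun h => ?_, fun h => h ▸ f3 v⟩
    rw [toPart_injective ((f3 w).symm.trans h)]
  have hR : ∀ x ∈ X, ∀ v : Vertex n, star x * x = toPart v ↔ x = g v := by
    intro x hx v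
    rw [← hg] at hx
    obtain ⟨w, rfl⟩ := hx
    refine ⟨fun h => ?_, fun h => h ▸ g3 v⟩
    rw [toPart_injective ((g3 w).symm.trans h)]
  have hJ : ∀ x ∈ X, x ∈ topClass n := by
    intro x hx
    rw [← hf] at hx
    obtain ⟨w, rfl⟩ := hx
    exact f2 w
  refine ⟨⟨fun p q => ∃ x ∈ X, x * star x = toPart p ∧ star x * x = toPart q⟩, ⟨?_, fun v => ?_⟩, ?_⟩
  · rintro p q ⟨x, hx, h1, h2⟩
    rw [Gam_adj, ← h1, ← h2, mul_star_self_mul_star_mul_self (hX.1.1 x hx)]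
    exact hJ x hx
  · simp only [Set.encard_eq_one]
    refine ⟨⟨vertexMk (star_mul_self_mem (f2 v)), Set.ext fun w => ?_⟩,
      ⟨vertexMk (mul_star_self_mem (g2 v)), Set.ext fun w => ?_⟩⟩
    · constructor
      · rintro ⟨x, hx, h1, h2⟩
        rw [hL x hx] at h1
        subst h1
        exact toPart_injective h2.symm
      · rintro rfl
        exact ⟨f v, f1 v, f3 v, rfl⟩
    · constructor
      · rintro ⟨x, hx, h1, h2⟩
        rw [hR x hx] at h2
        subst h2
        exact toPart_injective h1.symm
      · rintro rfl
        exact ⟨g v, g1 v, rfl, g3 v⟩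
  · ext e
    rw [mem_edgeProducts]
    constructor
    · rintro ⟨p, q, ⟨x, hx, h1, h2⟩, rfl⟩
      rwa [← h1, ← h2, mul_star_self_mul_star_mul_self (hX.1.1 x hx)]
    · intro he
      exact ⟨vertexMk (mul_star_self_mem (hJ e he)), vertexMk (star_mul_self_mem (hJ e he)),
        ⟨e, he, rfl, rfl⟩, mul_star_self_mul_star_mul_self (hX.1.1 e he)⟩

theorem bijOn_edgeProducts (n : ℕ) : Set.BijOn (edgeProducts (n := n))
    {G | G.IsBalancedSubgraph (Gam n)} {X | IsMinimalIdempotentGeneratingSet X} :=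
  ⟨fun _ hG => isMinimalIdempotentGeneratingSet_edgeProducts hG,
    edgeProducts_injOn.mono fun _ hG => hG.1, fun _ hX => exists_edgeProducts_eq hX⟩

end PartitionMonoid

/-! ### Balanced subgraphs and permutations -/

theorem Digraph.card_isBalancedSubgraph {V : Type*} (G : Digraph V) :
    {H : Digraph V | H.IsBalancedSubgraph G}.ncard =
      Nat.card {σ : Equiv.Perm V // ∀ v, G.Adj v (σ v)} := by
  let f : {σ : Equiv.Perm V // ∀ v, G.Adj v (σ v)} → {H : Digraph V | H.IsBalancedSubgraph G} :=
    fun σ => ⟨⟨fun v w => σ.1 v = w⟩, Digraph.isBalancedSubgraph_iff.2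
      ⟨fun v w h => h ▸ σ.2 v, σ.1, fun _ _ => Iff.rfl⟩⟩
  refine (Nat.card_eq_of_bijective f ⟨fun σ τ h => ?_, fun H => ?_⟩).symm
  · refine Subtype.ext (Equiv.ext fun v => ?_)
    have h1 := congrArg (fun H => (H : Digraph V).Adj v (τ.1 v)) (Subtype.ext_iff.1 h)
    exact (iff_of_eq h1).2 rfl
  · obtain ⟨hle, σ, hσ⟩ := Digraph.isBalancedSubgraph_iff.1 H.2
    refine ⟨⟨σ, fun v => hle ((hσ v _).2 rfl)⟩, Subtype.ext ?_⟩
    ext v w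
    exact (hσ v w).symm

/-- The incidence graph of points and pairs of points, with all loops. -/
def incidenceDigraph (N : Type*) : Digraph (Sym2 N) where
  Adj u v := u = v ∨ (∃ i j, u = s(i, i) ∧ v = s(i, j)) ∨ ∃ i j, v = s(i, i) ∧ u = s(i, j)

/-! ### The projection graph as the incidence graph of points and pairs. -/

namespace PartitionMonoid

variable {n : ℕ}

/-- The left projection of `pq = qp` is both `p` and `q`. -/
theorem eq_of_commute {p q : PartitionMonoid n} (hp : p ∈ topProjections n)
    (hq : q ∈ topProjections n) (h : Commute p q) (hpq : p * q ∈ topClass n) : p = q := by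
  rw [← mul_mul_star_mul_of_proj hp hpq, h.eq, mul_mul_star_mul_of_proj hq (h.eq ▸ hpq)]

theorem commute_pt_pt (i j : Fin n) : Commute (pt i) (pt j) := by
  have key : ∀ i j : Fin n, ∀ P R, (pt i * pt j).Resp P R ↔ ∀ x, x ≠ i → x ≠ j → (P x ↔ R x) := by
    intro i j P R
    simp only [resp_mul, resp_pt]
    constructor
    · exact fun ⟨Q, h1, h2⟩ x hi hj => (h1 x hi).trans (h2 x hj)
    · refine fun h => ⟨fun x => if x = i then R x else P x, fun x hx => by simp [hx],
        fun x hx => ?_⟩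
      by_cases hi : x = i
      · simp [hi]
      · simpa [hi] using h x hi hx
  exact ext_resp fun P R => by
    rw [key, key]
    exact forall_congr' fun _ => forall_comm

theorem commute_pt_pr {i k l : Fin n} (hk : k ≠ i) (hl : l ≠ i) : Commute (pt i) (pr k l) :=
  ext_resp fun P R => by
    simp only [resp_mul, resp_pt, resp_pr]
    constructor
    · rintro ⟨Q, h1, rfl, h2⟩
      exact ⟨P, ⟨rfl, by rw [h1 k hk, h1 l hl, h2]⟩, h1⟩
    · rintro ⟨Q, ⟨rfl, h1⟩, h2⟩
      exact ⟨R, h2, rfl, by rw [← h2 k hk, ← h2 l hl, h1]⟩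

theorem commute_pr_pr (i j k l : Fin n) : Commute (pr i j) (pr k l) :=
  ext_resp fun P R => by
    simp only [resp_mul, resp_pr]
    constructor
    · rintro ⟨Q, ⟨rfl, h1⟩, rfl, h2⟩
      exact ⟨P, ⟨rfl, h2⟩, rfl, h1⟩
    · rintro ⟨Q, ⟨rfl, h1⟩, rfl, h2⟩
      exact ⟨P, ⟨rfl, h2⟩, rfl, h1⟩

theorem part_mul_part_comm {u v : Sym2 (Fin n)} (h : part u * part v ∈ topClass n) :
    part v * part u ∈ topClass n := by
  have := star_mem_topClass h
  rwa [star_mul, (part_mem u).2.isSelfAdjoint.star_eq, (part_mem v).2.isSelfAdjoint.star_eq] at this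

/-- Multiplying by `pr i j` on the left gives back `pr i j`, so the rank has not dropped. -/
theorem pt_mul_pr_mem {i j : Fin n} (h : i ≠ j) : pt i * pr i j ∈ topClass n := by
  have h1 := rank_mul_le_right (pr i j) (pt i * pr i j)
  have h2 := rank_mul_le_left (pt i) (pr i j)
  rw [← mul_assoc, pr_mul_pt_mul_pr h] at h1
  have h3 := pt_mem_topClass i
  have h4 := pr_mem_topClass h
  rw [mem_topClass_iff] at *
  omega

theorem part_injective : Function.Injective (part (n := n)) := fun u _ h =>
  eq_of_part_mul_part (h ▸ (part_mem u).2.isIdempotentElem.eq)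

theorem part_mul_part_mem_iff (u v : Sym2 (Fin n)) :
    part u * part v ∈ topClass n ↔ (incidenceDigraph (Fin n)).Adj u v := by
  have hcomm : ∀ {u v : Sym2 (Fin n)}, Commute (part u) (part v) →
      part u * part v ∈ topClass n → u = v := fun h h' =>
    part_injective (eq_of_commute (part_mem _) (part_mem _) h h')
  have hsp : ∀ i k l : Fin n, k ≠ l → part s(i, i) * part s(k, l) ∈ topClass n →
      ∃ j, s(k, l) = s(i, j) := by
    intro i k l hkl h
    by_cases hk : k = i
    · exact ⟨l, hk ▸ rfl⟩
    by_cases hl : l = i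
    · exact ⟨k, hl ▸ Sym2.eq_swap⟩
    · exact ⟨i, (hcomm (by
        rw [part_self, part_of_ne hkl]; exact commute_pt_pr hk hl) h).symm⟩
  have hps : ∀ i j : Fin n, part s(i, i) * part s(i, j) ∈ topClass n := by
    intro i j
    by_cases h : i = j
    · rw [← h, (part_mem _).2.isIdempotentElem.eq]
      exact (part_mem _).1
    · rw [part_self, part_of_ne h]
      exact pt_mul_pr_mem h
  constructor
  · intro h
    induction u using sym2_cases with
    | self i =>
      induction v using sym2_cases with
      | self k => exact Or.inl (hcomm (by simpa [part_self] using commute_pt_pt i k) h)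
      | ne k l hkl =>
        obtain ⟨j, hj⟩ := hsp i k l hkl h
        exact Or.inr (Or.inl ⟨i, j, rfl, hj⟩)
    | ne i j hij =>
      induction v using sym2_cases with
      | self k =>
        obtain ⟨j, hj⟩ := hsp k i j hij (part_mul_part_comm h)
        exact Or.inr (Or.inr ⟨k, j, rfl, hj⟩)
      | ne k l hkl =>
        refine Or.inl (hcomm ?_ h)
        rw [part_of_ne hij, part_of_ne hkl]
        exact commute_pr_pr i j k l
  · rintro (rfl | ⟨i, j, rfl, rfl⟩ | ⟨i, j, rfl, rfl⟩)
    · rw [(part_mem _).2.isIdempotentElem.eq]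
      exact (part_mem _).1
    · exact hps i j
    · exact part_mul_part_comm (hps i j)

/-- The vertices of `Gam n` are indexed by the points and the pairs of points. -/
noncomputable def vertexEquiv (n : ℕ) : Sym2 (Fin n) ≃ Vertex n :=
  Equiv.ofBijective (fun u => vertexMk (part_mem u))
    ⟨fun _ _ h => part_injective (congrArg toPart h), fun p => by
      obtain ⟨u, hu⟩ := exists_part_eq (toPart_mem p)
      exact ⟨u, toPart_injective hu⟩⟩

theorem Gam_adj_vertexEquiv (u v : Sym2 (Fin n)) :
    (Gam n).Adj (vertexEquiv n u) (vertexEquiv n v) ↔ (incidenceDigraph (Fin n)).Adj u v := by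
  rw [Gam_adj, ← part_mul_part_mem_iff]
  rfl

theorem card_balanced_Gam (n : ℕ) : {G | Digraph.IsBalancedSubgraph G (Gam n)}.ncard =
    Nat.card {σ : Equiv.Perm (Sym2 (Fin n)) // ∀ v, (incidenceDigraph (Fin n)).Adj v (σ v)} := by
  rw [Digraph.card_isBalancedSubgraph]
  refine (Nat.card_congr (Equiv.subtypeEquiv (vertexEquiv n).permCongr fun σ => ?_)).symm
  rw [← (vertexEquiv n).forall_congr_right]
  simp only [Equiv.permCongr_apply, Equiv.symm_apply_apply, Gam_adj_vertexEquiv]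

end PartitionMonoid

/-! ### Permutations along the incidence graph -/

/-- The permutations of the points and pairs that move along the incidence graph are encoded by a
map `h` of points without 2-cycles and a set `A` of points, permuted by `h` without fixed points,
those on a cycle with at least three points. -/
structure IsCycleData {N : Type*} (A : Set N) (h : N → N) : Prop where
  eq_of_apply_apply : ∀ x, h (h x) = x → h x = x
  mapsTo : ∀ x ∈ A, h x ∈ A
  injOn : Set.InjOn h A
  ne : ∀ x ∈ A, h x ≠ x

namespace IsCycleData

variable {N : Type*} {A : Set N} {h : N → N}

/-- A crosswise coincidence would make `h` interchange `i` and `j`. Thus a pair `{i, h i}` with `h i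
≠ i` determines `i`, and the choice made in `toFun` is forced. -/
theorem eq_of_pair_eq (hA : IsCycleData A h) {i j : N} (hi : h i ≠ i)
    (hij : s(i, h i) = s(j, h j)) : i = j := by
  rcases Sym2.eq_iff.1 hij with ⟨h1, -⟩ | ⟨h1, h2⟩
  · exact h1
  · exact absurd (hA.eq_of_apply_apply i (by rw [h2, ← h1])) hi

open Classical in
/-- The permutation encoded by `A` and `h`, as a map. -/
noncomputable def toFun (A : Set N) (h : N → N) (v : Sym2 N) : Sym2 N :=
  if hv : ∃ i, v = s(i, i) then s(hv.choose, h hv.choose)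
  else if hv : ∃ i, v = s(i, h i) then
    if hv.choose ∈ A then s(h hv.choose, h hv.choose) else s(hv.choose, hv.choose)
  else v

theorem toFun_self (A : Set N) (h : N → N) (i : N) : toFun A h s(i, i) = s(i, h i) := by
  have hv : ∃ j, s(i, i) = s(j, j) := ⟨i, rfl⟩
  have : hv.choose = i := by
    have h1 := hv.choose_spec
    generalize hv.choose = j at h1
    rcases Sym2.eq_iff.1 h1 with h2 | h2 <;> exact h2.1.symm
  rw [toFun, dif_pos hv, this]

theorem not_exists_self {i j : N} (hij : i ≠ j) : ¬ ∃ k, s(i, j) = s(k, k) := by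
  rintro ⟨k, hk⟩
  rcases Sym2.eq_iff.1 hk with ⟨rfl, rfl⟩ | ⟨rfl, rfl⟩ <;> exact hij rfl

theorem choose_eq (hA : IsCycleData A h) {i : N} (hi : h i ≠ i)
    (hv : ∃ j, s(i, h i) = s(j, h j)) : hv.choose = i :=
  (hA.eq_of_pair_eq hi hv.choose_spec).symm

theorem toFun_of_mem (hA : IsCycleData A h) {i : N} (hi : i ∈ A) :
    toFun A h s(i, h i) = s(h i, h i) := by
  have hi' := hA.ne i hi
  have hv : ∃ j, s(i, h i) = s(j, h j) := ⟨i, rfl⟩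
  rw [toFun, dif_neg (not_exists_self hi'.symm), dif_pos hv, hA.choose_eq hi' hv, if_pos hi]

theorem toFun_of_notMem (hA : IsCycleData A h) {i : N} (hi' : h i ≠ i) (hi : i ∉ A) :
    toFun A h s(i, h i) = s(i, i) := by
  have hv : ∃ j, s(i, h i) = s(j, h j) := ⟨i, rfl⟩
  rw [toFun, dif_neg (not_exists_self hi'.symm), dif_pos hv, hA.choose_eq hi' hv, if_neg hi]

theorem toFun_of_ne {v : Sym2 N} (h1 : ∀ i, v ≠ s(i, i)) (h2 : ∀ i, v ≠ s(i, h i)) :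
    toFun A h v = v := by
  rw [toFun, dif_neg (by simpa using h1), dif_neg (by simpa using h2)]

theorem eq_cases (A : Set N) (h : N → N) (v : Sym2 N) :
    (∃ i, v = s(i, i)) ∨ (∃ i ∈ A, v = s(i, h i)) ∨ (∃ i, h i ≠ i ∧ i ∉ A ∧ v = s(i, h i)) ∨
      (∀ i, v ≠ s(i, i)) ∧ ∀ i, v ≠ s(i, h i) := by
  by_cases h1 : ∃ i, v = s(i, i)
  · exact Or.inl h1
  by_cases h2 : ∃ i, v = s(i, h i)
  · obtain ⟨i, rfl⟩ := h2
    by_cases hi : i ∈ A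
    · exact Or.inr (Or.inl ⟨i, hi, rfl⟩)
    · exact Or.inr (Or.inr (Or.inl ⟨i, fun hh => h1 ⟨i, by rw [hh]⟩, hi, rfl⟩))
  · exact Or.inr (Or.inr (Or.inr ⟨by simpa using h1, by simpa using h2⟩))

theorem self_eq_self_iff {i j : N} : s(i, i) = s(j, j) ↔ i = j := by simp

theorem pair_eq_self_iff {i j k : N} : s(i, j) = s(k, k) ↔ i = k ∧ j = k := by simp

/-- Values coming from points, from pairs moving forward and from pairs moving back are kept apart
by `h1`, `h2`, `h3`; all remaining vertices are fixed. -/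
theorem toFun_injective (hA : IsCycleData A h) : Function.Injective (toFun A h) := by
  have h1 : ∀ i, ∀ j ∈ A, s(i, h i) ≠ s(h j, h j) := by
    intro i j hj hij
    have h2 := pair_eq_self_iff.1 hij
    exact hA.ne i (h2.1 ▸ hA.mapsTo j hj) (h2.2.trans h2.1.symm)
  have h2 : ∀ i j, h j ≠ j → s(i, h i) ≠ s(j, j) := by
    intro i j hj hij
    have h2 := pair_eq_self_iff.1 hij
    exact hj (h2.1 ▸ h2.2.trans h2.1.symm)
  have h3 : ∀ i ∈ A, ∀ j ∉ A, s(h i, h i) ≠ s(j, j) := fun i hi j hj hij =>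
    hj (self_eq_self_iff.1 hij ▸ hA.mapsTo i hi)
  intro u v huv
  rcases eq_cases A h u with ⟨i, rfl⟩ | ⟨i, hi, rfl⟩ | ⟨i, hi, hi', rfl⟩ | ⟨hu, hu'⟩ <;>
    [rw [toFun_self] at huv; rw [hA.toFun_of_mem hi] at huv;
      rw [hA.toFun_of_notMem hi hi'] at huv; rw [toFun_of_ne hu hu'] at huv] <;>
    rcases eq_cases A h v with ⟨j, rfl⟩ | ⟨j, hj, rfl⟩ | ⟨j, hj, hj', rfl⟩ | ⟨hv, hv'⟩ <;>
    [rw [toFun_self] at huv; rw [hA.toFun_of_mem hj] at huv;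
      rw [hA.toFun_of_notMem hj hj'] at huv; rw [toFun_of_ne hv hv'] at huv;
      rw [toFun_self] at huv; rw [hA.toFun_of_mem hj] at huv;
      rw [hA.toFun_of_notMem hj hj'] at huv; rw [toFun_of_ne hv hv'] at huv;
      rw [toFun_self] at huv; rw [hA.toFun_of_mem hj] at huv;
      rw [hA.toFun_of_notMem hj hj'] at huv; rw [toFun_of_ne hv hv'] at huv;
      rw [toFun_self] at huv; rw [hA.toFun_of_mem hj] at huv;
      rw [hA.toFun_of_notMem hj hj'] at huv; rw [toFun_of_ne hv hv'] at huv]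
  · by_cases hi : h i = i
    · rw [hi, eq_comm, pair_eq_self_iff] at huv
      rw [huv.1]
    · rw [hA.eq_of_pair_eq hi huv]
  · exact absurd huv (h1 i j hj)
  · exact absurd huv (h2 i j hj)
  · exact absurd huv.symm (hv' i)
  · exact absurd huv.symm (h1 j i hi)
  · rw [hA.injOn hi hj (self_eq_self_iff.1 huv)]
  · exact absurd huv (h3 i hi j hj')
  · exact absurd huv.symm (hv _)
  · exact absurd huv.symm (h2 j i hi)
  · exact absurd huv.symm (h3 j hj i hi')
  · rw [self_eq_self_iff.1 huv]
  · exact absurd huv.symm (hv i)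
  · exact absurd huv (hu' j)
  · exact absurd huv (hu _)
  · exact absurd huv (hu j)
  · exact huv

theorem adj_toFun (hA : IsCycleData A h) (v : Sym2 N) :
    (incidenceDigraph N).Adj v (toFun A h v) := by
  rcases eq_cases A h v with ⟨i, rfl⟩ | ⟨i, hi, rfl⟩ | ⟨i, hi, hi', rfl⟩ | ⟨hu, hu'⟩
  · rw [toFun_self]
    exact Or.inr (Or.inl ⟨i, h i, rfl, rfl⟩)
  · rw [hA.toFun_of_mem hi]
    exact Or.inr (Or.inr ⟨h i, i, rfl, Sym2.eq_swap⟩)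
  · rw [hA.toFun_of_notMem hi hi']
    exact Or.inr (Or.inr ⟨i, h i, rfl, rfl⟩)
  · rw [toFun_of_ne hu hu']
    exact Or.inl rfl

theorem mem_iff (hA : IsCycleData A h) (i : N) :
    i ∈ A ↔ h i ≠ i ∧ toFun A h s(i, h i) = s(h i, h i) := by
  refine ⟨fun hi => ⟨hA.ne i hi, hA.toFun_of_mem hi⟩, fun ⟨hi, hi'⟩ => ?_⟩
  by_contra hc
  rw [hA.toFun_of_notMem hi hc, self_eq_self_iff] at hi'
  exact hi hi'.symm

theorem eq_of_toFun_eq {A' : Set N} {h' : N → N} (hA : IsCycleData A h) (hA' : IsCycleData A' h')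
    (heq : toFun A h = toFun A' h') : A = A' ∧ h = h' := by
  have hh : h = h' := funext fun i => by
    have := congrFun heq s(i, i)
    rwa [toFun_self, toFun_self, Sym2.congr_right] at this
  subst hh
  refine ⟨Set.ext fun i => ?_, rfl⟩
  rw [hA.mem_iff, hA'.mem_iff, heq]

theorem exists_toFun_eq [Finite N] {σ : Equiv.Perm (Sym2 N)}
    (hσ : ∀ v, (incidenceDigraph N).Adj v (σ v)) :
    ∃ A h, IsCycleData A h ∧ toFun A h = σ := by
  have h1 : ∀ i, ∃ j, σ s(i, i) = s(i, j) := by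
    intro i
    rcases hσ s(i, i) with hv | ⟨k, j, hk, hj⟩ | ⟨k, j, hk, hj⟩
    · exact ⟨i, hv.symm⟩
    · rw [self_eq_self_iff] at hk
      exact ⟨j, hk ▸ hj⟩
    · rw [eq_comm, pair_eq_self_iff] at hj
      exact ⟨i, hj.1 ▸ hk⟩
  choose h hh using h1
  have h2 : ∀ i, h i ≠ i → σ s(i, h i) = s(i, i) ∨ σ s(i, h i) = s(h i, h i) := by
    intro i hi
    rcases hσ s(i, h i) with hv | ⟨k, j, hk, hj⟩ | ⟨k, j, hk, hj⟩
    · rw [← hh i, σ.injective.eq_iff, hh i, eq_comm, pair_eq_self_iff] at hv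
      exact absurd hv.2 hi
    · rw [pair_eq_self_iff] at hk
      exact absurd (hk.2.trans hk.1.symm) hi
    · rcases Sym2.eq_iff.1 hj with ⟨rfl, -⟩ | ⟨-, rfl⟩
      · exact Or.inl hk
      · exact Or.inr hk
  -- On a 2-cycle of `h` both points would be sent to the same pair.
  have hno : ∀ i, h (h i) = i → h i = i := by
    intro i hi
    have : σ s(h i, h i) = σ s(i, i) := by rw [hh, hh, hi, Sym2.eq_swap]
    exact self_eq_self_iff.1 (σ.injective this)
  let A : Set N := {i | h i ≠ i ∧ σ s(i, h i) = s(h i, h i)}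
  -- The point `h i` is already the image of `{i, h i}`, so it is not fixed by `σ` and the next pair
  -- cannot return to it: forward motion continues.
  have hmaps : ∀ i ∈ A, h i ∈ A := by
    rintro i ⟨hi, hi'⟩
    have hne : h (h i) ≠ h i := by
      intro hc
      have h3 : σ s(h i, h i) = s(h i, h i) := by rw [hh, hc]
      rw [← hi', σ.injective.eq_iff, hi', eq_comm, pair_eq_self_iff] at h3
      exact hi h3.1.symm
    refine ⟨hne, (h2 (h i) hne).resolve_left fun hc => ?_⟩
    rw [← hi', σ.injective.eq_iff, Sym2.eq_iff] at hc
    rcases hc with ⟨h3, -⟩ | ⟨-, h3⟩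
    · exact hi h3
    · exact hi (hno i h3)
  have hA : IsCycleData A h := by
    refine ⟨hno, hmaps, fun i hi j hj hij => ?_, fun i hi => hi.1⟩
    have h3 : s(i, h i) = s(j, h j) := σ.injective (by rw [hi.2, hj.2, hij])
    rw [hij, Sym2.congr_left] at h3
    exact h3
  refine ⟨A, h, hA, funext fun v => ?_⟩
  rcases eq_cases A h v with ⟨i, rfl⟩ | ⟨i, hi, rfl⟩ | ⟨i, hi, hi', rfl⟩ | ⟨hu, hu'⟩
  · rw [toFun_self, hh]
  · rw [hA.toFun_of_mem hi, hi.2]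
  · rw [hA.toFun_of_notMem hi hi']
    exact ((h2 i hi).resolve_right fun hc => hi' ⟨hi, hc⟩).symm
  · rw [toFun_of_ne hu hu']
    -- The preimage of `v` is examined: a point would be sent to some `{k, h k}`, and `v` is no
    -- point, so only `v` itself remains.
    have h3 := hσ (σ.symm v)
    rw [Equiv.apply_symm_apply] at h3
    rcases h3 with hv | ⟨k, j, hk, hj⟩ | ⟨k, j, hk, hj⟩
    · rw [Equiv.symm_apply_eq] at hv
      exact hv
    · rw [Equiv.symm_apply_eq, hh] at hk
      exact absurd hk (hu' k)
    · exact absurd hk (hu k)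

end IsCycleData

theorem card_perm_incidenceDigraph (N : Type*) [Finite N] :
    Nat.card {σ : Equiv.Perm (Sym2 N) // ∀ v, (incidenceDigraph N).Adj v (σ v)} =
      Nat.card (Σ A : Set N, {h : N → N // IsCycleData A h}) := by
  let f : (Σ A : Set N, {h : N → N // IsCycleData A h}) →
      {σ : Equiv.Perm (Sym2 N) // ∀ v, (incidenceDigraph N).Adj v (σ v)} := fun x =>
    ⟨Equiv.ofBijective _ (Finite.injective_iff_bijective.1 x.2.2.toFun_injective),
      fun v => x.2.2.adj_toFun v⟩
  refine (Nat.card_eq_of_bijective f ⟨?_, fun σ => ?_⟩).symm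
  · rintro ⟨A, h, hA⟩ ⟨A', h', hA'⟩ heq
    have h1 : IsCycleData.toFun A h = IsCycleData.toFun A' h' :=
      congrArg DFunLike.coe (Subtype.ext_iff.1 heq)
    obtain ⟨rfl, rfl⟩ := hA.eq_of_toFun_eq hA' h1
    rfl
  · obtain ⟨A, h, hA, heq⟩ := IsCycleData.exists_toFun_eq σ.2
    exact ⟨⟨A, h, hA⟩, Subtype.ext (Equiv.ext (congrFun heq))⟩

/-! ### Counting cycle data -/

/-- The number of permutations without fixed points and 2-cycles. -/
noncomputable def cardPermNoShortCycle (α : Type*) : ℕ :=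
  Nat.card {π : Equiv.Perm α // ∀ x, π x ≠ x ∧ π (π x) ≠ x}

/-- `f` is the identity outside `S` and has no 2-cycles. -/
def NoTwoCycleOn {N : Type*} (S : Set N) (f : N → N) : Prop :=
  (∀ x ∉ S, f x = x) ∧ ∀ x, f (f x) = x → f x = x

-- `h` maps `A` to itself, so no 2-cycle meets both `A` and its complement, and the two restrictions
-- of `h` are independent. Off `A` the values may lie anywhere; that part is made total by the
-- identity on `A`.
open Classical in
theorem card_isCycleData {N : Type*} [Finite N] (A : Set N) :
    Nat.card {h : N → N // IsCycleData A h} =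
      cardPermNoShortCycle A * Nat.card {f : N → N // NoTwoCycleOn Aᶜ f} := by
  rw [cardPermNoShortCycle, ← Nat.card_prod]
  let F : {π : Equiv.Perm A // ∀ x, π x ≠ x ∧ π (π x) ≠ x} × {f : N → N // NoTwoCycleOn Aᶜ f} →
      (N → N) := fun y x => if hx : x ∈ A then y.1.1 ⟨x, hx⟩ else y.2.1 x
  have hF1 : ∀ y x (hx : x ∈ A), F y x = y.1.1 ⟨x, hx⟩ := fun y x hx => dif_pos hx
  have hF2 : ∀ y, ∀ x ∉ A, F y x = y.2.1 x := fun y x hx => dif_neg hx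
  have hF3 : ∀ y, ∀ x ∈ A, F y x ∈ A := fun y x hx => by
    rw [hF1 y x hx]
    exact Subtype.coe_prop _
  have hF : ∀ y, IsCycleData A (F y) := by
    intro y
    refine ⟨fun x hxx => ?_, hF3 y, fun a ha b hb hab => ?_, fun x hx => ?_⟩
    · by_cases hx : x ∈ A
      · exfalso
        rw [hF1 y x hx, hF1 y _ (Subtype.coe_prop _)] at hxx
        exact (y.1.2 ⟨x, hx⟩).2 (Subtype.ext hxx)
      · have hx' : F y x ∉ A := fun hc => hx (hxx ▸ hF3 y _ hc)
        rw [hF2 y _ hx', hF2 y x hx] at hxx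
        rw [hF2 y x hx]
        exact y.2.2.2 x hxx
    · rw [hF1 y a ha, hF1 y b hb] at hab
      simpa using y.1.1.injective (Subtype.ext hab)
    · rw [hF1 y x hx]
      exact fun hc => (y.1.2 ⟨x, hx⟩).1 (Subtype.ext hc)
  refine (Nat.card_eq_of_bijective (fun y => (⟨F y, hF y⟩ : {h : N → N // IsCycleData A h}))
    ⟨fun y z hyz => ?_, fun h => ?_⟩).symm
  · have hyz' : ∀ x, F y x = F z x := congrFun (Subtype.ext_iff.1 hyz)
    refine Prod.ext (Subtype.ext (Equiv.ext fun x => Subtype.ext ?_))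
      (Subtype.ext (funext fun x => ?_))
    · rw [← hF1 y x x.2, ← hF1 z x x.2, hyz']
    · by_cases hx : x ∈ A
      · rw [y.2.2.1 x (by simpa using hx), z.2.2.1 x (by simpa using hx)]
      · rw [← hF2 y x hx, ← hF2 z x hx, hyz']
  · obtain ⟨h, hA⟩ := h
    have hinj : Function.Injective (fun x : A => (⟨h x, hA.mapsTo x x.2⟩ : A)) := fun x y hxy =>
      Subtype.ext (hA.injOn x.2 y.2 (Subtype.ext_iff.1 hxy))
    refine ⟨(⟨Equiv.ofBijective _ (Finite.injective_iff_bijective.1 hinj), fun x => ⟨fun hc => ?_,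
      fun hc => ?_⟩⟩, ⟨fun x => if x ∈ A then x else h x, fun x hx => ?_, fun x hxx => ?_⟩), ?_⟩
    · exact hA.ne x x.2 (Subtype.ext_iff.1 hc)
    · exact hA.ne x x.2 (hA.eq_of_apply_apply x (Subtype.ext_iff.1 hc))
    · exact if_pos (by simpa using hx)
    · by_cases hx : x ∈ A
      · exact if_pos hx
      · simp only [hx, if_false] at hxx ⊢
        split_ifs at hxx with h1
        · exact hxx
        · exact hA.eq_of_apply_apply x hxx
    · refine Subtype.ext (funext fun x => ?_)
      by_cases hx : x ∈ A
      · exact hF1 _ x hx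
      · exact (hF2 _ x hx).trans (if_neg hx)

theorem cardPermNoShortCycle_congr {α β : Type*} (e : α ≃ β) :
    cardPermNoShortCycle α = cardPermNoShortCycle β := by
  refine Nat.card_congr (Equiv.subtypeEquiv e.permCongr fun π => ?_)
  rw [← e.forall_congr_right]
  simp only [Equiv.permCongr_apply, Equiv.symm_apply_apply, ne_eq, e.injective.eq_iff]

theorem aNum_eq (k : ℕ) : aNum k = cardPermNoShortCycle (Fin k) := by
  refine Nat.card_congr (Equiv.subtypeEquivRight fun π => ?_)
  simp only [HasTwoCycle, Fin.val_inj]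
  constructor
  · exact fun ⟨h1, h2⟩ x => ⟨h1 x, fun h3 => h2 ⟨x, π x, (h1 x).symm, rfl, h3⟩⟩
  · refine fun h => ⟨fun x => (h x).1, ?_⟩
    rintro ⟨x, y, -, h1, h2⟩
    exact (h x).2 (by rw [h1, h2])

theorem cardPermNoShortCycle_eq_aNum (α : Type*) [Finite α] :
    cardPermNoShortCycle α = aNum (Nat.card α) := by
  rw [aNum_eq]
  exact cardPermNoShortCycle_congr (Finite.equivFin α)

/-! ### The recurrence for permutations without fixed points and 2-cycles -/

section

variable {α : Type*} [DecidableEq α]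

theorem decomposeOption_symm_none (a : α) (σ : Equiv.Perm α) :
    Equiv.Perm.decomposeOption.symm (some a, σ) none = some a := by
  simp [Equiv.Perm.decomposeOption_symm_apply]

theorem decomposeOption_symm_some (a : α) (σ : Equiv.Perm α) (x : α) :
    Equiv.Perm.decomposeOption.symm (some a, σ) (some x) =
      if σ x = a then none else some (σ x) := by
  split_ifs with h
  · simp [Equiv.Perm.decomposeOption_symm_apply, h]
  · rw [Equiv.Perm.decomposeOption_symm_apply, Equiv.Perm.mul_apply, Equiv.optionCongr_apply,
      Option.map_some, Equiv.swap_apply_of_ne_of_ne (Option.some_ne_none _)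
        (fun hc => h (Option.some_injective _ hc))]

/-- `σ` arises by cutting `none`, the predecessor of `a`, out of its cycle. Only that cycle gets
shorter, so `σ` may have one 2-cycle, through `a`, left over from a 3-cycle. -/
theorem decomposeOption_symm_noShortCycle_iff (a : α) (σ : Equiv.Perm α) :
    (∀ x, Equiv.Perm.decomposeOption.symm (some a, σ) x ≠ x ∧
      Equiv.Perm.decomposeOption.symm (some a, σ)
        (Equiv.Perm.decomposeOption.symm (some a, σ) x) ≠ x) ↔
    ∀ x, σ x ≠ x ∧ (σ (σ x) = x → x = a ∨ σ x = a) := by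
  set π := Equiv.Perm.decomposeOption.symm (some a, σ) with hπ
  have h0 : π none = some a := decomposeOption_symm_none a σ
  have h1 : ∀ x, σ x = a → π (some x) = none := fun x hx => by
    rw [hπ, decomposeOption_symm_some, if_pos hx]
  have h2 : ∀ x, σ x ≠ a → π (some x) = some (σ x) := fun x hx => by
    rw [hπ, decomposeOption_symm_some, if_neg hx]
  constructor
  · intro h
    have ha : σ a ≠ a := fun hc => (h none).2 (by rw [h0, h1 a hc])
    refine fun x => ⟨fun hx => ?_, fun hx => ?_⟩
    · by_cases hxa : σ x = a
      · exact ha (by rw [← hxa, hx, hx])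
      · exact (h (some x)).1 (by rw [h2 x hxa, hx])
    · by_contra! hc
      exact (h (some x)).2 (by rw [h2 x hc.2, h2 _ (by rw [hx]; exact hc.1), hx])
  · rintro h (_ | x)
    · rw [h0, h2 a (h a).1]
      exact ⟨Option.some_ne_none _, Option.some_ne_none _⟩
    · by_cases hxa : σ x = a
      · rw [h1 x hxa, h0]
        refine ⟨(Option.some_ne_none _).symm, fun hc => (h x).1 ?_⟩
        rw [hxa, Option.some_injective _ hc]
      · rw [h2 x hxa]
        refine ⟨fun hc => (h x).1 (Option.some_injective _ hc), ?_⟩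
        by_cases hxa' : σ (σ x) = a
        · rw [h1 _ hxa']
          exact (Option.some_ne_none _).symm
        · rw [h2 _ hxa']
          intro hc
          have hc := Option.some_injective _ hc
          rcases (h x).2 hc with h3 | h3
          · exact hxa' (hc.trans h3)
          · exact hxa h3

theorem cardPermNoShortCycle_option :
    cardPermNoShortCycle (Option α) = Nat.card {y : α × Equiv.Perm α //
      ∀ x, y.2 x ≠ x ∧ (y.2 (y.2 x) = x → x = y.1 ∨ y.2 x = y.1)} := by
  refine (Nat.card_eq_of_bijective
    (fun y => ⟨Equiv.Perm.decomposeOption.symm (some y.1.1, y.1.2),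
      (decomposeOption_symm_noShortCycle_iff y.1.1 y.1.2).2 y.2⟩) ⟨fun y z hyz => ?_, ?_⟩).symm
  · have h := Equiv.Perm.decomposeOption.symm.injective (Subtype.ext_iff.1 hyz)
    rw [Prod.mk.injEq] at h
    exact Subtype.ext (Prod.ext (Option.some_injective _ h.1) h.2)
  · rintro ⟨π, hπ⟩
    obtain ⟨⟨o, σ⟩, rfl⟩ := Equiv.Perm.decomposeOption.symm.surjective π
    cases o with
    | none =>
      exact absurd (by simp [Equiv.Perm.decomposeOption_symm_apply]) (hπ none).1
    | some a =>
      exact ⟨⟨(a, σ), (decomposeOption_symm_noShortCycle_iff a σ).1 hπ⟩, rfl⟩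

theorem card_perm_swap (a b : α) :
    Nat.card {σ : Equiv.Perm α // (σ a = b ∧ σ b = a) ∧
      ∀ x, x ≠ a ∧ x ≠ b → σ x ≠ x ∧ σ (σ x) ≠ x} =
    cardPermNoShortCycle {x : α // x ≠ a ∧ x ≠ b} := by
  have key : ∀ τ : Equiv.Perm {x : α // x ≠ a ∧ x ≠ b}, ∀ x : {x : α // x ≠ a ∧ x ≠ b},
      (Equiv.Perm.ofSubtype τ * Equiv.swap a b) x = τ x := fun τ x => by
    rw [Equiv.Perm.mul_apply, Equiv.swap_apply_of_ne_of_ne x.2.1 x.2.2,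
      Equiv.Perm.ofSubtype_apply_coe]
  have ha : ∀ τ : Equiv.Perm {x : α // x ≠ a ∧ x ≠ b},
      (Equiv.Perm.ofSubtype τ * Equiv.swap a b) a = b := fun τ => by
    rw [Equiv.Perm.mul_apply, Equiv.swap_apply_left,
      Equiv.Perm.ofSubtype_apply_of_not_mem _ (by simp)]
  have hb : ∀ τ : Equiv.Perm {x : α // x ≠ a ∧ x ≠ b},
      (Equiv.Perm.ofSubtype τ * Equiv.swap a b) b = a := fun τ => by
    rw [Equiv.Perm.mul_apply, Equiv.swap_apply_right,
      Equiv.Perm.ofSubtype_apply_of_not_mem _ (by simp)]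
  have hc : ∀ τ : {τ : Equiv.Perm {x : α // x ≠ a ∧ x ≠ b} // ∀ x, τ x ≠ x ∧ τ (τ x) ≠ x},
      ∀ x, x ≠ a ∧ x ≠ b → (Equiv.Perm.ofSubtype τ.1 * Equiv.swap a b) x ≠ x ∧
        (Equiv.Perm.ofSubtype τ.1 * Equiv.swap a b)
          ((Equiv.Perm.ofSubtype τ.1 * Equiv.swap a b) x) ≠ x := fun τ x hx => by
    have h1 := key τ.1 ⟨x, hx⟩
    have h2 := key τ.1 (τ.1 ⟨x, hx⟩)
    dsimp only at h1
    rw [h1, h2]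
    exact ⟨fun hc => (τ.2 ⟨x, hx⟩).1 (Subtype.ext hc), fun hc => (τ.2 ⟨x, hx⟩).2 (Subtype.ext hc)⟩
  refine (Nat.card_eq_of_bijective (fun τ => ⟨Equiv.Perm.ofSubtype τ.1 * Equiv.swap a b,
    ⟨ha τ.1, hb τ.1⟩, hc τ⟩) ⟨fun τ τ' h => ?_, fun σ => ?_⟩).symm
  · exact Subtype.ext (Equiv.Perm.ofSubtype_injective (mul_right_cancel (Subtype.ext_iff.1 h)))
  · obtain ⟨σ, ⟨h1, h2⟩, h3⟩ := σ
    have hp : ∀ x, (σ x ≠ a ∧ σ x ≠ b) ↔ (x ≠ a ∧ x ≠ b) := fun x => by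
      have e1 : σ x ≠ a ↔ x ≠ b := by rw [← h2, σ.injective.ne_iff]
      have e2 : σ x ≠ b ↔ x ≠ a := by rw [← h1, σ.injective.ne_iff]
      rw [e1, e2, and_comm]
    refine ⟨⟨σ.subtypePerm hp, fun x => ⟨fun hc => (h3 x x.2).1 (Subtype.ext_iff.1 hc),
      fun hc => (h3 x x.2).2 (Subtype.ext_iff.1 hc)⟩⟩, Subtype.ext (Equiv.ext fun x => ?_)⟩
    change (Equiv.Perm.ofSubtype (σ.subtypePerm hp) * Equiv.swap a b) x = σ x
    by_cases hxa : x = a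
    · rw [hxa, ha, h1]
    by_cases hxb : x = b
    · rw [hxb, hb, h2]
    exact key (σ.subtypePerm hp) ⟨x, hxa, hxb⟩

/-- The 2-cycle is given by an ordered pair of distinct points `(a, σ a)`; the rest is a permutation
of the other points without short cycles. -/
theorem card_perm_pointed_two_cycle [Finite α] :
    Nat.card {y : α × Equiv.Perm α //
      (∀ x, y.2 x ≠ x ∧ (y.2 (y.2 x) = x → x = y.1 ∨ y.2 x = y.1)) ∧ y.2 (y.2 y.1) = y.1} =
    Nat.card α * (Nat.card α - 1) * aNum (Nat.card α - 2) := by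
  let F : (Σ e : {e : α × α // e.1 ≠ e.2}, {σ : Equiv.Perm α // (σ e.1.1 = e.1.2 ∧ σ e.1.2 = e.1.1) ∧
      ∀ x, x ≠ e.1.1 ∧ x ≠ e.1.2 → σ x ≠ x ∧ σ (σ x) ≠ x}) →
      {y : α × Equiv.Perm α //
        (∀ x, y.2 x ≠ x ∧ (y.2 (y.2 x) = x → x = y.1 ∨ y.2 x = y.1)) ∧ y.2 (y.2 y.1) = y.1} :=
    fun z => ⟨(z.1.1.1, z.2.1), fun x => by
      obtain ⟨⟨⟨a, b⟩, hab⟩, σ, ⟨h1, h2⟩, h3⟩ := z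
      dsimp only at *
      by_cases hxa : x = a
      · subst hxa
        exact ⟨h1 ▸ hab.symm, fun _ => Or.inl rfl⟩
      by_cases hxb : x = b
      · subst hxb
        exact ⟨h2 ▸ hab, fun _ => Or.inr h2⟩
      · exact ⟨(h3 x ⟨hxa, hxb⟩).1, fun hc => absurd hc (h3 x ⟨hxa, hxb⟩).2⟩, by
      obtain ⟨⟨⟨a, b⟩, hab⟩, σ, ⟨h1, h2⟩, h3⟩ := z
      dsimp only at *
      rw [h1, h2]⟩
  have hF : Function.Bijective F := by
    constructor
    · rintro ⟨⟨⟨a, b⟩, hab⟩, σ, ⟨h1, h2⟩, h3⟩ ⟨⟨⟨a', b'⟩, hab'⟩, σ', ⟨h1', h2'⟩, h3'⟩ h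
      have h := Subtype.ext_iff.1 h
      dsimp only [F] at h h1 h1'
      obtain ⟨rfl, rfl⟩ := Prod.mk.injEq .. ▸ h
      subst h1
      subst h1'
      rfl
    · rintro ⟨⟨a, σ⟩, h1, h2⟩
      dsimp only at h1 h2
      refine ⟨⟨⟨(a, σ a), (h1 a).1.symm⟩, σ, ⟨rfl, h2⟩, fun x hx => ⟨(h1 x).1, fun hc => ?_⟩⟩, rfl⟩
      rcases (h1 x).2 hc with h3 | h3
      · exact hx.1 h3
      · exact hx.2 (by rw [← hc, h3])
  have := Fintype.ofFinite α
  rw [← Nat.card_eq_of_bijective F hF, Nat.card_sigma]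
  have hcard : ∀ e : {e : α × α // e.1 ≠ e.2}, Nat.card {x : α // x ≠ e.1.1 ∧ x ≠ e.1.2} =
      Nat.card α - 2 := by
    rintro ⟨⟨a, b⟩, hab⟩
    have h1 : Nat.card {x : α // x ≠ a ∧ x ≠ b} = (({a, b} : Finset α)ᶜ).card := by
      rw [Nat.card_eq_fintype_card, Fintype.card_subtype]
      congr 1
      ext x
      simp
    rw [h1, Finset.card_compl, Finset.card_pair hab, Nat.card_eq_fintype_card]
  have hterm : ∀ e : {e : α × α // e.1 ≠ e.2},
      Nat.card {σ : Equiv.Perm α // (σ e.1.1 = e.1.2 ∧ σ e.1.2 = e.1.1) ∧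
        ∀ x, x ≠ e.1.1 ∧ x ≠ e.1.2 → σ x ≠ x ∧ σ (σ x) ≠ x} = aNum (Nat.card α - 2) := fun e => by
    rw [card_perm_swap, cardPermNoShortCycle_eq_aNum, hcard]
  simp only [hterm, Finset.sum_const, smul_eq_mul]
  congr 1
  have h1 : (Finset.univ : Finset {e : α × α // e.1 ≠ e.2}).card =
      (Finset.univ : Finset α).offDiag.card := by
    rw [Finset.card_univ, Fintype.card_subtype]
    congr 1
    ext x
    simp
  rw [Nat.card_eq_fintype_card, ← Finset.card_univ, Nat.mul_sub_one, ← Finset.offDiag_card, ← h1]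

end

theorem card_perm_pointed_no_two_cycle {α : Type*} :
    Nat.card {y : α × Equiv.Perm α //
      (∀ x, y.2 x ≠ x ∧ (y.2 (y.2 x) = x → x = y.1 ∨ y.2 x = y.1)) ∧ ¬ y.2 (y.2 y.1) = y.1} =
    Nat.card α * cardPermNoShortCycle α := by
  rw [cardPermNoShortCycle, ← Nat.card_prod]
  refine (Nat.card_eq_of_bijective (fun z : α × {π : Equiv.Perm α // ∀ x, π x ≠ x ∧ π (π x) ≠ x} =>
    ⟨(z.1, z.2.1), fun x => ⟨(z.2.2 x).1, fun hc => absurd hc (z.2.2 x).2⟩, (z.2.2 z.1).2⟩)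
    ⟨fun y z h => ?_, ?_⟩).symm
  · have h : (y.1, y.2.1) = (z.1, z.2.1) := Subtype.ext_iff.1 h
    rw [Prod.mk.injEq] at h
    exact Prod.ext h.1 (Subtype.ext h.2)
  · rintro ⟨⟨a, σ⟩, h1, h2⟩
    dsimp only at h1 h2
    refine ⟨⟨a, σ, fun x => ⟨(h1 x).1, fun hc => h2 ?_⟩⟩, rfl⟩
    rcases (h1 x).2 hc with h3 | h3
    · rw [← h3, hc]
    · rw [← h3, hc]

/-- Two cases: whether or not the marked point `a` lies on a 2-cycle after the cut. The truncated `k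
- 2` is harmless for `k < 2`, where `k * (k - 1)` vanishes, so `aNum 1` and `aNum 2` follow too. -/
theorem aNum_succ (k : ℕ) : aNum (k + 1) = k * aNum k + k * (k - 1) * aNum (k - 2) := by
  have h1 : aNum (k + 1) = cardPermNoShortCycle (Option (Fin k)) := by
    rw [aNum_eq]
    exact cardPermNoShortCycle_congr (finSuccEquiv k)
  have h2 := card_perm_pointed_two_cycle (α := Fin k)
  have h3 := card_perm_pointed_no_two_cycle (α := Fin k)
  rw [Nat.card_fin] at h2 h3
  rw [h1, cardPermNoShortCycle_option, aNum_eq k, ← h2, ← h3, add_comm]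
  let D : Fin k × Equiv.Perm (Fin k) → Prop := fun y =>
    ∀ x, y.2 x ≠ x ∧ (y.2 (y.2 x) = x → x = y.1 ∨ y.2 x = y.1)
  let q : Fin k × Equiv.Perm (Fin k) → Prop := fun y => y.2 (y.2 y.1) = y.1
  have := Nat.card_congr (Equiv.sumCompl fun y : {y // D y} => q y)
  rw [Nat.card_sum, Nat.card_congr (Equiv.subtypeSubtypeEquivSubtypeInter D q),
    Nat.card_congr (Equiv.subtypeSubtypeEquivSubtypeInter D fun y => ¬ q y)] at this
  exact this.symm

theorem aNum_zero : aNum 0 = 1 := by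
  have : Unique {π : Equiv.Perm (Fin 0) // ∀ x, π x ≠ x ∧ π (π x) ≠ x} :=
    ⟨⟨1, fun x => x.elim0⟩, fun π => Subtype.ext (Equiv.ext fun x => x.elim0)⟩
  rw [aNum_eq]
  exact Nat.card_unique

theorem aNum_one : aNum 1 = 0 := by simpa using aNum_succ 0

theorem aNum_two : aNum 2 = 0 := by simpa [aNum_one] using aNum_succ 1

/-! ### Counting maps without 2-cycles -/

section

variable {N : Type*} [Fintype N] [DecidableEq N]

open Classical in
/-- The maps that are the identity outside `S` and have no 2-cycles. -/
noncomputable def noTwoCycleMaps (S : Finset N) : Finset (N → N) :=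
  Finset.univ.filter fun f => NoTwoCycleOn (S : Set N) f

theorem mem_noTwoCycleMaps {S : Finset N} {f : N → N} :
    f ∈ noTwoCycleMaps S ↔ (∀ x ∉ S, f x = x) ∧ ∀ x, f (f x) = x → f x = x := by
  simp [noTwoCycleMaps, NoTwoCycleOn]

theorem card_noTwoCycleMaps_empty : (noTwoCycleMaps (∅ : Finset N)).card = 1 := by
  rw [Finset.card_eq_one]
  refine ⟨id, Finset.ext fun f => ?_⟩
  rw [mem_noTwoCycleMaps, Finset.mem_singleton]
  constructor
  · exact fun h => funext fun x => h.1 x (Finset.notMem_empty x)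
  · rintro rfl
    exact ⟨fun _ _ => rfl, fun _ _ => rfl⟩

/-- `a` is a fixed point, so a point `x` sent to `a` is on no cycle and can be turned into a fixed
point, and back. -/
theorem card_noTwoCycleMaps_erase {S : Finset N} {a x : N} (ha : a ∉ S) (hx : x ∈ S) :
    ((noTwoCycleMaps S).filter fun f => f x = a).card = (noTwoCycleMaps (S.erase x)).card := by
  have hax : a ≠ x := fun h => ha (h ▸ hx)
  refine Finset.card_nbij' (fun f => Function.update f x x) (fun g => Function.update g x a)
    (fun f hf => ?_) (fun g hg => ?_) (fun f hf => ?_) (fun g hg => ?_) <;> dsimp only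
  · rw [Finset.mem_coe, Finset.mem_filter, mem_noTwoCycleMaps] at hf
    rw [Finset.mem_coe, mem_noTwoCycleMaps]
    refine ⟨fun z hz => ?_, fun z hz => ?_⟩
    · by_cases hzx : z = x
      · simp [hzx]
      · rw [Function.update_of_ne hzx]
        exact hf.1.1 z fun h => hz (Finset.mem_erase.2 ⟨hzx, h⟩)
    · by_cases hzx : z = x
      · simp [hzx]
      · rw [Function.update_of_ne hzx] at hz ⊢
        by_cases hfz : f z = x
        · rw [hfz, Function.update_self] at hz
          exact hfz.trans hz
        · rw [Function.update_of_ne hfz] at hz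
          exact hf.1.2 z hz
  · rw [Finset.mem_coe, mem_noTwoCycleMaps] at hg
    rw [Finset.mem_coe, Finset.mem_filter, mem_noTwoCycleMaps]
    have hga : g a = a := hg.1 a fun h => ha (Finset.mem_of_mem_erase h)
    refine ⟨⟨fun z hz => ?_, fun z hz => ?_⟩, by simp⟩
    · have hzx : z ≠ x := fun h => hz (h ▸ hx)
      rw [Function.update_of_ne hzx]
      exact hg.1 z fun h => hz (Finset.mem_of_mem_erase h)
    · by_cases hzx : z = x
      · rw [hzx, Function.update_self, Function.update_of_ne hax, hga] at hz
        exact absurd hz hax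
      · rw [Function.update_of_ne hzx] at hz ⊢
        by_cases hgz : g z = x
        · rw [hgz, Function.update_self] at hz
          rw [← hz, hga]
        · rw [Function.update_of_ne hgz] at hz
          exact hg.2 z hz
  · rw [Finset.mem_coe, Finset.mem_filter] at hf
    simp [← hf.2]
  · rw [Finset.mem_coe, mem_noTwoCycleMaps] at hg
    have hgx : g x = x := hg.1 x (Finset.notMem_erase x S)
    simp [hgx]

/-- The right side counts a value at `a` together with a map moving only points of `S`. The
combination has a 2-cycle exactly when `a ↦ x ↦ a` with `x ∈ S`; these cases form the sum. -/
theorem card_noTwoCycleMaps_insert {S : Finset N} {a : N} (ha : a ∉ S) :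
    (noTwoCycleMaps (insert a S)).card + ∑ x ∈ S, (noTwoCycleMaps (S.erase x)).card =
      Fintype.card N * (noTwoCycleMaps S).card := by
  rw [← Finset.card_univ, ← Finset.card_product,
    ← Finset.card_filter_add_card_filter_not (s := Finset.univ ×ˢ noTwoCycleMaps S)
      (fun z => ¬ (z.1 ∈ S ∧ z.2 z.1 = a))]
  congr 1
  · refine Finset.card_nbij' (fun f => (f a, Function.update f a a))
      (fun z => Function.update z.2 a z.1) (fun f hf => ?_) (fun z hz => ?_) (fun f hf => ?_)
      (fun z hz => ?_)
    · rw [Finset.mem_coe, mem_noTwoCycleMaps] at hf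
      simp only [Finset.mem_coe, Finset.mem_filter, Finset.mem_product, Finset.mem_univ, true_and,
        mem_noTwoCycleMaps]
      refine ⟨⟨fun z hz => ?_, fun z hz => ?_⟩, fun ⟨h1, h2⟩ => ?_⟩
      · by_cases hza : z = a
        · simp [hza]
        · rw [Function.update_of_ne hza]
          exact hf.1 z (by simp [hza, hz])
      · by_cases hza : z = a
        · simp [hza]
        · rw [Function.update_of_ne hza] at hz ⊢
          by_cases hfz : f z = a
          · rw [hfz, Function.update_self] at hz
            exact absurd hz.symm hza
          · rw [Function.update_of_ne hfz] at hz
            exact hf.2 z hz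
      · have h3 : f a ≠ a := fun h => ha (h ▸ h1)
        rw [Function.update_of_ne h3] at h2
        exact h3 (hf.2 a h2)
    · simp only [Finset.mem_coe, Finset.mem_filter, Finset.mem_product, Finset.mem_univ, true_and,
        mem_noTwoCycleMaps] at hz
      obtain ⟨⟨h1, h2⟩, h3⟩ := hz
      dsimp only
      rw [Finset.mem_coe, mem_noTwoCycleMaps]
      refine ⟨fun x hx => ?_, fun x hx => ?_⟩
      · rw [Finset.mem_insert, not_or] at hx
        rw [Function.update_of_ne hx.1]
        exact h1 x hx.2
      · have key : ∀ x, x ≠ a → z.2 x = a → z.1 ≠ x := fun x hxa hxz hc => h3 ⟨by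
          by_contra hS
          exact hxa (by rw [← hxz, ← hc, h1 _ hS]), hc ▸ hxz⟩
        by_cases hxa : x = a
        · subst hxa
          rw [Function.update_self] at hx ⊢
          by_contra hne
          rw [Function.update_of_ne hne] at hx
          exact key _ hne hx rfl
        · rw [Function.update_of_ne hxa] at hx ⊢
          by_cases hzx : z.2 x = a
          · rw [hzx, Function.update_self] at hx
            exact absurd hx (key x hxa hzx)
          · rw [Function.update_of_ne hzx] at hx
            exact h2 x hx
    · simp
    · simp only [Finset.mem_coe, Finset.mem_filter, Finset.mem_product, Finset.mem_univ, true_and,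
        mem_noTwoCycleMaps] at hz
      have h1 : z.2 a = a := hz.1.1 a ha
      refine Prod.ext (by simp) ?_
      dsimp only
      rw [Function.update_idem, Function.update_eq_self_iff, h1]
  · rw [Finset.sum_congr rfl fun x hx => (card_noTwoCycleMaps_erase ha hx).symm,
      ← Finset.card_sigma]
    refine Finset.card_nbij' (fun y => (y.1, y.2)) (fun z => ⟨z.1, z.2⟩) ?_ ?_ ?_ ?_
    · rintro ⟨x, f⟩ h
      simp only [Finset.mem_coe, Finset.mem_sigma, Finset.mem_filter] at h
      simp [h]
    · rintro ⟨x, f⟩ h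
      simp only [Finset.mem_coe, Finset.mem_filter, Finset.mem_product, not_not] at h
      simp [h]
    · intro _ _
      rfl
    · intro _ _
      rfl

end

/-- The signed number of `i`-matchings of `k` points, weighted by `n ^ (k - 2 * i)`. -/
def matchingTerm (n k i : ℕ) : ℤ :=
  (-1 : ℤ) ^ i * (k.choose (2 * i) : ℤ) * (Nat.doubleFactorial (2 * i - 1) : ℤ) *
    (n : ℤ) ^ (k - 2 * i)

theorem matchingTerm_eq_zero {n k i : ℕ} (h : k < 2 * i) : matchingTerm n k i = 0 := by
  simp [matchingTerm, Nat.choose_eq_zero_of_lt h]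

theorem matchingTerm_succ_zero (n k : ℕ) :
    matchingTerm n (k + 1) 0 = n * matchingTerm n k 0 := by
  simp [matchingTerm, pow_succ']

/-- A matching of `k + 2` points either omits a given point or pairs it with one of the `k + 1`
others. -/
theorem matchingTerm_succ_succ (n k i : ℕ) : matchingTerm n (k + 2) (i + 1) =
    n * matchingTerm n (k + 1) (i + 1) - (k + 1) * matchingTerm n k i := by
  have h1 : ((k + 2).choose (2 * (i + 1)) : ℤ) =
      (k + 1).choose (2 * i + 1) + (k + 1).choose (2 * (i + 1)) := by
    have := Nat.choose_succ_succ (k + 1) (2 * i + 1)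
    exact_mod_cast this
  have h2 : ((k + 1).choose (2 * i + 1) : ℤ) * Nat.doubleFactorial (2 * (i + 1) - 1) =
      (k + 1) * (k.choose (2 * i) * Nat.doubleFactorial (2 * i - 1)) := by
    have h3 : Nat.doubleFactorial (2 * (i + 1) - 1) =
        (2 * i + 1) * Nat.doubleFactorial (2 * i - 1) := by
      -- For `i = 0`, truncation gives `2 * i - 1 = 0`, and `0‼ = 1` plays the role of `(-1)!!`.
      cases i with
      | zero => rfl
      | succ i => exact Nat.doubleFactorial_add_two (2 * i + 1)
    have h4 := Nat.add_one_mul_choose_eq k (2 * i)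
    have h5 : (k + 1).choose (2 * i + 1) * Nat.doubleFactorial (2 * (i + 1) - 1) =
        (k + 1) * (k.choose (2 * i) * Nat.doubleFactorial (2 * i - 1)) := by
      rw [h3, ← mul_assoc, ← h4, mul_assoc]
    exact_mod_cast h5
  have h6 : ((k + 1).choose (2 * (i + 1)) : ℤ) * (n : ℤ) ^ (k - 2 * i) =
      n * ((k + 1).choose (2 * (i + 1)) * (n : ℤ) ^ (k + 1 - 2 * (i + 1))) := by
    -- Here truncated subtraction breaks the exponent identity, but the binomial coefficient is
    -- zero.
    by_cases hk : k + 1 < 2 * (i + 1)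
    · simp [Nat.choose_eq_zero_of_lt hk]
    · have : k - 2 * i = k + 1 - 2 * (i + 1) + 1 := by omega
      rw [this, pow_succ]
      ring
  have h7 : k + 2 - 2 * (i + 1) = k - 2 * i := by omega
  simp only [matchingTerm]
  rw [h1, h7, pow_succ (-1 : ℤ)]
  linear_combination (-(-1 : ℤ) ^ i * (n : ℤ) ^ (k - 2 * i)) * h2 -
    (-1 : ℤ) ^ i * (Nat.doubleFactorial (2 * (i + 1) - 1)) * h6

/-- Terms beyond `k / 2` vanish, so sums for different `k` can be brought to a common range. -/
theorem sum_matchingTerm (n k M : ℕ) (h : k / 2 < M) :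
    ∑ i ∈ Finset.range (k / 2 + 1), matchingTerm n k i =
      ∑ i ∈ Finset.range M, matchingTerm n k i := by
  refine Finset.sum_subset (Finset.range_subset_range.2 h) fun i _ hi => matchingTerm_eq_zero ?_
  rw [Finset.mem_range] at hi
  omega

theorem sum_matchingTerm_add_two (n k : ℕ) :
    ∑ i ∈ Finset.range ((k + 2) / 2 + 1), matchingTerm n (k + 2) i =
      n * ∑ i ∈ Finset.range ((k + 1) / 2 + 1), matchingTerm n (k + 1) i -
        (k + 1) * ∑ i ∈ Finset.range (k / 2 + 1), matchingTerm n k i := by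
  rw [sum_matchingTerm n (k + 2) (k + 3) (by omega), sum_matchingTerm n (k + 1) (k + 3) (by omega),
    sum_matchingTerm n k (k + 2) (by omega), Finset.sum_range_succ' _ (k + 2),
    Finset.sum_range_succ' (matchingTerm n (k + 1)) (k + 2), matchingTerm_succ_zero n (k + 1)]
  simp only [matchingTerm_succ_succ, Finset.sum_sub_distrib, ← Finset.mul_sum]
  ring

theorem card_noTwoCycleMaps {N : Type*} [Fintype N] [DecidableEq N] (k : ℕ) :
    ∀ S : Finset N, S.card = k → ((noTwoCycleMaps S).card : ℤ) =
      ∑ i ∈ Finset.range (k / 2 + 1), matchingTerm (Fintype.card N) k i := by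
  induction k using Nat.strong_induction_on with
  | _ k ih =>
    intro S hS
    rcases S.eq_empty_or_nonempty with rfl | ⟨a, ha⟩
    · rw [Finset.card_empty] at hS
      subst hS
      simp [card_noTwoCycleMaps_empty, matchingTerm]
    · obtain ⟨T, haT, rfl⟩ : ∃ T : Finset N, a ∉ T ∧ insert a T = S :=
        ⟨S.erase a, Finset.notMem_erase a S, Finset.insert_erase ha⟩
      rw [Finset.card_insert_of_notMem haT] at hS
      have h1 := card_noTwoCycleMaps_insert haT
      have h2 := ih T.card (by omega) T rfl
      have h1' : ((noTwoCycleMaps (insert a T)).card : ℤ) =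
          Fintype.card N * ((noTwoCycleMaps T).card : ℤ) -
            ∑ x ∈ T, ((noTwoCycleMaps (T.erase x)).card : ℤ) := by
        rw [eq_sub_iff_add_eq]
        exact_mod_cast h1
      rw [h1', h2]
      obtain rfl | ⟨m, rfl⟩ : k = 1 ∨ ∃ m, k = m + 2 := by
        rcases k with _ | _ | m
        · omega
        · exact Or.inl rfl
        · exact Or.inr ⟨m, rfl⟩
      · have hT : T = ∅ := Finset.card_eq_zero.1 (by omega)
        simp [hT, matchingTerm]
      · have hT : T.card = m + 1 := by omega
        rw [Finset.sum_congr rfl fun x hx => ih m (by omega) (T.erase x)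
          (by rw [Finset.card_erase_of_mem hx]; omega), Finset.sum_const, hT,
          sum_matchingTerm_add_two]
        simp

/-! ### The numbers `bNum n k` and the final count. -/

/-- A map on the first `k` points is extended by the identity; the added fixed points lie on no
2-cycle. -/
theorem bNum_eq_card {n k : ℕ} (hk : k ≤ n) :
    bNum n k = (noTwoCycleMaps (Finset.univ.filter fun x : Fin n => (x : ℕ) < k)).card := by
  set S := Finset.univ.filter fun x : Fin n => (x : ℕ) < k with hS
  have hmem : ∀ x : Fin n, x ∈ S ↔ (x : ℕ) < k := fun x => by simp [hS]
  let F : (Fin k → Fin n) → Fin n → Fin n := fun τ x => if hx : (x : ℕ) < k then τ ⟨x, hx⟩ else x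
  have hF1 : ∀ τ (x : Fin n) (hx : (x : ℕ) < k), F τ x = τ ⟨x, hx⟩ := fun τ x hx => dif_pos hx
  have hF2 : ∀ τ (x : Fin n), ¬ (x : ℕ) < k → F τ x = x := fun τ x hx => dif_neg hx
  have hF3 : ∀ τ, ¬ HasTwoCycle τ ↔ F τ ∈ noTwoCycleMaps S := by
    intro τ
    rw [mem_noTwoCycleMaps]
    constructor
    · refine fun h => ⟨fun x hx => hF2 τ x (by rwa [hmem] at hx), fun x hxx => ?_⟩
      by_contra hne
      have hx : (x : ℕ) < k := by
        by_contra hx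
        exact hne (hF2 τ x hx)
      have hx' : (F τ x : ℕ) < k := by
        by_contra hx'
        rw [hF2 τ _ hx'] at hxx
        exact hne hxx
      refine h ⟨⟨x, hx⟩, ⟨F τ x, hx'⟩, fun hc => hne (Fin.ext (Fin.ext_iff.1 hc).symm), ?_, ?_⟩
      · rw [← hF1 τ x hx]
      · rw [← hF1 τ _ hx', hxx]
    · rintro ⟨-, h⟩ ⟨x, y, hxy, h1, h2⟩
      have h3 : ∀ x y : Fin k, (τ x : ℕ) = y →
          F τ (Fin.castLE hk x) = Fin.castLE hk y := fun x y h => by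
        rw [hF1 τ _ (by simp)]
        exact Fin.ext h
      have h4 := h (Fin.castLE hk x) (by rw [h3 x y h1, h3 y x h2])
      rw [h3 x y h1] at h4
      exact hxy (Fin.castLE_injective hk h4).symm
  have hF4 : ∀ f ∈ noTwoCycleMaps S, F (fun x => f (Fin.castLE hk x)) = f := by
    intro f hf
    rw [mem_noTwoCycleMaps] at hf
    funext x
    by_cases hx : (x : ℕ) < k
    · exact hF1 (fun y => f (Fin.castLE hk y)) x hx
    · exact (hF2 (fun y => f (Fin.castLE hk y)) x hx).trans (hf.1 x (by rwa [hmem])).symm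
  rw [← Nat.card_eq_finsetCard]
  refine Nat.card_eq_of_bijective (fun τ => ⟨F τ.1, (hF3 τ.1).1 τ.2⟩) ⟨fun τ τ' h => ?_, fun f => ?_⟩
  · refine Subtype.ext (funext fun x => ?_)
    have h1 := congrFun (Subtype.ext_iff.1 h) (Fin.castLE hk x)
    dsimp only at h1
    rwa [hF1 _ _ (by simp), hF1 _ _ (by simp)] at h1
  · have h1 := hF4 f.1 f.2
    exact ⟨⟨fun x => f.1 (Fin.castLE hk x), (hF3 _).2 (by rw [h1]; exact f.2)⟩, Subtype.ext h1⟩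

theorem bNum_eq_sum {n k : ℕ} (hk : k ≤ n) :
    (bNum n k : ℤ) = ∑ i ∈ Finset.range (k / 2 + 1), matchingTerm n k i := by
  have hcard : (Finset.univ.filter fun x : Fin n => (x : ℕ) < k).card = k := by
    rw [← Nat.card_eq_finsetCard, ← Nat.card_fin k]
    refine (Nat.card_eq_of_bijective
      (fun x : Fin k => ⟨Fin.castLE hk x, by simp⟩) ⟨fun x y h => ?_, fun x => ?_⟩).symm
    · exact Fin.castLE_injective hk (Subtype.ext_iff.1 h)
    · exact ⟨⟨x.1, by simpa using x.2⟩, rfl⟩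
  have := card_noTwoCycleMaps k _ hcard
  rwa [Fintype.card_fin, ← bNum_eq_card hk] at this

/-- The closed formula depends only on the size of `S`, so no relabelling of points is needed. -/
theorem card_noTwoCycleMaps_eq_bNum {n : ℕ} (S : Finset (Fin n)) :
    (noTwoCycleMaps S).card = bNum n S.card := by
  have h1 := card_noTwoCycleMaps S.card S rfl
  rw [Fintype.card_fin, ← bNum_eq_sum (card_finset_fin_le S)] at h1
  exact_mod_cast h1

theorem card_sigma_isCycleData (n : ℕ) :
    Nat.card (Σ A : Set (Fin n), {h : Fin n → Fin n // IsCycleData A h}) =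
      ∑ k ∈ Finset.range (n + 1), n.choose k * aNum k * bNum n (n - k) := by
  classical
  have hterm : ∀ A : Finset (Fin n), Nat.card {h : Fin n → Fin n // IsCycleData (A : Set (Fin n)) h} =
      aNum A.card * bNum n (n - A.card) := by
    intro A
    have h1 : Nat.card {f : Fin n → Fin n // NoTwoCycleOn (A : Set (Fin n))ᶜ f} =
        (noTwoCycleMaps Aᶜ).card := by
      rw [Nat.card_eq_fintype_card, Fintype.card_subtype, noTwoCycleMaps]
      simp
    rw [card_isCycleData, cardPermNoShortCycle_eq_aNum, h1, card_noTwoCycleMaps_eq_bNum,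
      Finset.card_compl, Fintype.card_fin]
    simp
  rw [Nat.card_sigma]
  have h2 := Equiv.sum_comp (Fintype.finsetEquivSet (α := Fin n))
    (fun A => Nat.card {h : Fin n → Fin n // IsCycleData A h})
  rw [← h2]
  simp only [Fintype.finsetEquivSet_apply, hterm]
  have h3 := Finset.sum_powerset_apply_card (fun k => aNum k * bNum n (n - k))
    (x := (Finset.univ : Finset (Fin n)))
  rw [Finset.powerset_univ, Finset.card_univ, Fintype.card_fin] at h3
  rw [h3]
  simp [mul_assoc]

theorem mainTheorem4 (n : ℕ) :
    Set.BijOn (edgeProducts (n := n))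
      {G | G.IsBalancedSubgraph (Gam n)}
      {X | PartitionMonoid.IsMinimalIdempotentGeneratingSet X} ∧
    {X : Set (PartitionMonoid n) | PartitionMonoid.IsMinimalIdempotentGeneratingSet X}.ncard =
      {G | Digraph.IsBalancedSubgraph G (Gam n)}.ncard ∧
    {X : Set (PartitionMonoid n) | PartitionMonoid.IsMinimalIdempotentGeneratingSet X}.ncard =
      ∑ k ∈ Finset.range (n + 1), n.choose k * aNum k * bNum n (n - k) ∧
    (aNum 0 = 1 ∧ aNum 1 = 0 ∧ aNum 2 = 0 ∧
      ∀ k, 2 ≤ k → aNum (k + 1) = k * aNum k + k * (k - 1) * aNum (k - 2)) ∧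
    ∀ k, k ≤ n → (bNum n k : ℤ) =
      ∑ i ∈ Finset.range (k / 2 + 1),
        (-1 : ℤ) ^ i * (k.choose (2 * i) : ℤ) * (Nat.doubleFactorial (2 * i - 1) : ℤ) *
          (n : ℤ) ^ (k - 2 * i) := by
  have hbij := PartitionMonoid.bijOn_edgeProducts n
  have hcard : {X : Set (PartitionMonoid n) |
      PartitionMonoid.IsMinimalIdempotentGeneratingSet X}.ncard =
      {G | Digraph.IsBalancedSubgraph G (Gam n)}.ncard := by
    rw [← hbij.image_eq, hbij.injOn.ncard_image]
  refine ⟨hbij, hcard, ?_, ⟨aNum_zero, aNum_one, aNum_two, fun k _ => aNum_succ k⟩,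
    fun k hk => bNum_eq_sum hk⟩
  rw [hcard, PartitionMonoid.card_balanced_Gam, card_perm_incidenceDigraph,
    card_sigma_isCycleData]
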